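/- Let $d\ge 3$ and let $\hbar,m,\beta,\rho>0$. Consider $N$ free bosons of mass $m$ at inverse temperature $\beta$ on the $d$-dimensional torus of side length $L$, with one-particle energies $\epsilon_{\mathbf k}=\hbar^2\mathbf k^2/2m$, $\mathbf k\in\frac{2\pi}{L}\mathbb Z^d$, and put $\lambda_\beta=\sqrt{2\pi\hbar^2\beta/m}$. In the canonical partition function $Q^0_N=\operatorname{Tr}P_+e^{-\beta H^0_N}=\frac1{N!}\sum_{\pi\in S_N}\operatorname{Tr}U_\pi e^{-\beta H^0_N}$, where $U_\pi$ permutes the particles, the permutation $\pi$ has the weight $\operatorname{Tr}U_\pi e^{-\beta H^0_N}=\prod_{c}q_{|c|}$, where $c$ runs over the cycles of $\pi$, $|c|$ is the length of $c$ and $q_n=\sum_{\mathbf k}e^{-n\beta\epsilon_{\mathbf k}}$. Let $P^0_{N,L}$ be the resulting probability measure on $S_N$, $\xi_1$ the length of the cycle that contains particle $1$, and $\langle N_{\mathbf 0}\rangle$ the canonical expectation value of the number of particles with momentum $\mathbf 0$. All limits $N,L\to\infty$ below are taken with $N/L^d=\rho$. Let $\rho_c=\lambda_\beta^{-d}\sum_{n\ge1}n^{-d/2}$.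 Let $\mu^0\le 0$ be the solution $\mu$ of $$\rho=\frac1{(2\pi)^d}\int_{\mathbb R^d}\frac{d\mathbf k}{e^{\beta(\hbar^2\mathbf k^2/2m-\mu)}-1}$$ if $\rho\le\rho_c$, and $\mu^0=0$ if $\rho\ge\rho_c$; this determines $\mu^0$ uniquely. Then for each $n\ge1$ the limit $$P^0_{\rho,\beta}(\xi_1=n)=\lim_{N,L\to\infty}P^0_{N,L}(\xi_1=n)=\frac{e^{n\beta\mu^0}}{\rho\lambda_\beta^d n^{d/2}}$$ exists, the limit of $P^0_{N,L}(\xi_1>\varepsilon N)$ exists for every $\varepsilon>0$, the density $\rho_0=\lim_{N,L\to\infty}\langle N_{\mathbf 0}\rangle/L^d$ of particles with zero momentum exists, the series below converge, and $$1-\sum_{n=1}^\infty P^0_{\rho,\beta}(\xi_1=n)=1-\frac1{\rho\lambda_\beta^d}\sum_{n=1}^\infty\frac{e^{n\beta\mu^0}}{n^{d/2}}=\lim_{\varepsilon\downarrow0}\ \lim_{N,L\to\infty}P^0_{N,L}(\xi_1>\varepsilon N)=\frac{\rho_0}{\rho}.$$ -/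

import Mathlib

open Filter Topology MeasureTheory

noncomputable section

namespace IdealBose

/-- Labels `z ∈ ℤ^d` of the plane waves `φ_k(x) = L^{-d/2} e^{i k·x}`, `k = (2π/L) z`, on the torus
of side `L`. -/
abbrev Mode (d : ℕ) : Type := Fin d → ℤ

/-- One-particle kinetic energy `ε_k = ℏ² |k|² / (2m)` at `k = (2π/L) z`. -/
def modeEnergy (d : ℕ) (hbar m L : ℝ) (z : Mode d) : ℝ :=
  hbar ^ 2 * (∑ i, (2 * Real.pi / L * (z i : ℝ)) ^ 2) / (2 * m)

/-- The thermal de Broglie wave length `λ_β = √(2πℏ²β/m)`. -/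
def thermalLength (hbar m β : ℝ) : ℝ := Real.sqrt (2 * Real.pi * hbar ^ 2 * β / m)

/-- The critical density `ζ(d/2) / λ_β^d`. -/
def criticalDensity (d : ℕ) (hbar m β : ℝ) : ℝ :=
  (∑' n : ℕ, 1 / ((n + 1 : ℕ) : ℝ) ^ ((d : ℝ) / 2)) / thermalLength hbar m β ^ d

/-- `μ` is the chemical potential of the infinite ideal gas at density `ρ`: the (nonpositive)
solution of Einstein's equation if `ρ` is at most the critical density, and `0` if `ρ` is at least
the critical density. -/
def IsChemicalPotential (d : ℕ) (hbar m β ρ μ : ℝ) : Prop :=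
  μ ≤ 0 ∧
  (ρ ≤ criticalDensity d hbar m β →
    ρ = 1 / (2 * Real.pi) ^ d *
      ∫ k : EuclideanSpace ℝ (Fin d),
        1 / (Real.exp (β * (hbar ^ 2 * ‖k‖ ^ 2 / (2 * m) - μ)) - 1)) ∧
  (criticalDensity d hbar m β ≤ ρ → μ = 0)

/-- `Tr (P₊ F e^{-βH})` for `N` free bosons on the torus of side `L`, resolved over permutations.
With `P₊ = (1/N!) ∑_π U_π` and the trace taken in the basis of products of plane waves, the
diagonal element of `U_π e^{-βH}` at `(z₁, …, z_N)` is `e^{-β ∑ ε(z_i)}` if `z` is constant on the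
cycles of `π`, and `0` otherwise. The weight of `π` alone (`F = 1`) is the product over the cycles
of `π` of `q_ℓ = Tr e^{-ℓβH₁}`, where `ℓ` is the length of the cycle. -/
def canonicalSum (d : ℕ) (hbar m β : ℝ) (N : ℕ) (L : ℝ)
    (F : Equiv.Perm (Fin N) → (Fin N → Mode d) → ℝ) : ℝ :=
  1 / (N.factorial : ℝ) *
    ∑ π : Equiv.Perm (Fin N), ∑' z : Fin N → Mode d,
      if ∀ i, z (π i) = z i then
        F π z * Real.exp (-β * ∑ i, modeEnergy d hbar m L (z i))
      else 0

/-- The canonical partition function `Q⁰_N = Tr P₊ e^{-βH}`. -/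
def partitionFunction (d : ℕ) (hbar m β : ℝ) (N : ℕ) (L : ℝ) : ℝ :=
  canonicalSum d hbar m β N L (fun _ _ => 1)

/-- The canonical expectation value. -/
def canonicalExpectation (d : ℕ) (hbar m β : ℝ) (N : ℕ) (L : ℝ)
    (F : Equiv.Perm (Fin N) → (Fin N → Mode d) → ℝ) : ℝ :=
  canonicalSum d hbar m β N L F / partitionFunction d hbar m β N L

/-- `ξ₁`: the length of the cycle of `π` that contains the first particle (`1` for a fixed point;
`0` by convention if there is no particle). -/
def cycleLengthOne {N : ℕ} (π : Equiv.Perm (Fin N)) : ℕ :=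
  if h : 0 < N then Function.minimalPeriod π ⟨0, h⟩ else 0

/-- `P⁰_{N,L}(ξ₁ ∈ S)`. -/
def cycleProb (d : ℕ) (hbar m β : ℝ) (N : ℕ) (L : ℝ) (S : Set ℕ) : ℝ :=
  canonicalExpectation d hbar m β N L (fun π _ => S.indicator 1 (cycleLengthOne π))

/-- `⟨N₀⟩`: the canonical expectation value of the number of particles with momentum zero. -/
def zeroModeOccupation (d : ℕ) (hbar m β : ℝ) (N : ℕ) (L : ℝ) : ℝ :=
  canonicalExpectation d hbar m β N L
    (fun _ z => ((Finset.univ.filter (fun i => z i = 0)).card : ℝ))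

/-- The side length `L` for which `N / L^d = ρ`. -/
def boxLength (d : ℕ) (ρ : ℝ) (N : ℕ) : ℝ := ((N : ℝ) / ρ) ^ (1 / (d : ℝ))

end IdealBose

end

/-!
# Infinite cycles and condensation in the ideal Bose gas

Write `w_k = e^{-βε_k}` for the Boltzmann factors on the torus of side `L`, so that `w_0 = 1`,
`q_n = ∑_k w_k ^ n` for the one-particle traces and `Z_N` for the canonical partition function.

*Combinatorics.* Deleting a particle from its cycle shows that the permutations in which that
particle lies in a cycle of length `n` contribute `q_n Z_{N-n} / N` to `Z_N`, and `Z_{N-n} / N` if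
the cycle is required to sit in the mode `0` (`markedSum_eq`, `sum_cycleTrace_marked`). Hence
`P(ξ₁ = n) = q_n Z_{N-n} / (N Z_N)` (`cycleProb_eq`), `⟨N₀⟩ = ∑_{n=1}^N Z_{N-n} / Z_N`
(`zeroModeOccupation_eq`), and `N Z_N = ∑_{n=1}^N q_n Z_{N-n}` (`bosonZ_recursion`).

*Fugacity.* For finitely many modes, `Z` is a convolution of geometric sequences, one of them
constant, so it is nondecreasing and log-concave; by the recursion this passes to infinitely many
modes (`isBoseSequence_bosonZ`). Thus the canonical fugacity `a_N = Z_N / Z_{N+1}` is nondecreasing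
and at most `1`. Log-concavity compares `Z_{N-n} / Z_N` with powers of `a_N` in both directions, and
the recursion then encloses the density between truncated and full grand canonical densities at
fugacity `a_N`. As `q_n / L^d → 1 / (λ^d n^{d/2})`, by Poisson summation for the theta series, the
only possible limit of `a_N` is the fugacity `x = e^{βμ}` of the infinite gas (`tendsto_ratio`), so
that `Z_{N-n} / Z_N → x ^ n`.

*Condensate.* In `1 = ∑_n q_n Z_{N-n} / (N Z_N)` the part with `q_n - 1` in place of `q_n` is
dominated by `C / n^{d/2}` up to an error `O(L / √N)`, which vanishes for `d ≥ 3`. Its limit is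
therefore the sum of the termwise limits, and what remains, `⟨N₀⟩ / N`, tends to
`t₀ = 1 - ∑_n P(ξ₁ = n)` (`tendsto_condensate_fraction`). For the same reason the long cycles are
governed by `Z_{N-n} / Z_N ∈ [0, 1]` alone. For `n > t N` with `t > t₀` the remaining gas has a
subcritical density, so its fugacity stays away from `1` and these ratios are geometrically small
(`tendsto_tail_zero`); since their mean is `t₀`, they must be close to `1` for `n < t₀ N`. So
`P(ξ₁ > ε N) → max (t₀ - ε) 0` (`tendsto_long_cycles`).
-/

noncomputable section

namespace IdealBose

/-! ### Permutation sums and marked cycles -/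

section PermutationSums

open Equiv

variable {ι : Type*}

/-- A finite product of nonnegative convergent series, expanded into a sum over multi-indices. -/
theorem hasSum_pi_prod {N : ℕ} (g : Fin N → ι → ℝ) (hg0 : ∀ i z, 0 ≤ g i z)
    (hg : ∀ i, Summable (g i)) :
    HasSum (fun z : Fin N → ι => ∏ i, g i (z i)) (∏ i, ∑' z, g i z) := by
  induction N with
  | zero =>
    simp [hasSum_unique]
  | succ N ih =>
    have h1 := ih (fun i => g i.succ) (fun i z => hg0 _ z) (fun i => hg _)
    have h0 : (0 : ι → ℝ) ≤ g 0 := fun z => hg0 0 z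
    have h0' : (0 : (Fin N → ι) → ℝ) ≤ fun y => ∏ i : Fin N, g i.succ (y i) :=
      fun y => Finset.prod_nonneg fun i _ => hg0 i.succ (y i)
    have h2 := Summable.mul_of_nonneg (hg 0) h1.summable h0 h0'
    have h3 := HasSum.mul (hg 0).hasSum h1 h2
    rw [Fin.prod_univ_succ, ← (Fin.consEquiv (fun _ => ι)).hasSum_iff]
    have h4 : (fun z : Fin (N + 1) → ι => ∏ i, g i (z i)) ∘ (Fin.consEquiv (fun _ => ι)) =
        fun x => g 0 x.1 * ∏ i : Fin N, g i.succ (x.2 i) := by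
      funext x
      simp [Fin.consEquiv, Fin.prod_univ_succ]
    rw [h4]
    exact h3

/-- The trace of `U_π F` against the Boltzmann weight: the sum of `F z * ∏ i, w (z i)` over the mode
assignments `z` that are constant on the cycles of `π`. -/
def cycleTrace (w : ι → ℝ) {N : ℕ} (π : Perm (Fin N)) (F : (Fin N → ι) → ℝ) : ℝ :=
  ∑' z : Fin N → ι, open Classical in
    if ∀ i, z (π i) = z i then F z * ∏ i, w (z i) else 0

theorem summable_cycleTrace {w : ι → ℝ} (hw0 : ∀ k, 0 ≤ w k) (hw : Summable w) {N : ℕ}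
    (π : Perm (Fin N)) {F : (Fin N → ι) → ℝ} {C : ℝ} (hF : ∀ z, |F z| ≤ C) :
    Summable fun z : Fin N → ι => open Classical in
      if ∀ i, z (π i) = z i then F z * ∏ i, w (z i) else 0 := by
  have h := (hasSum_pi_prod (N := N) (fun _ => w) (fun _ => hw0) (fun _ => hw)).summable
  refine Summable.of_norm_bounded (h.mul_left C) fun z => ?_
  have hp : 0 ≤ ∏ i, w (z i) := Finset.prod_nonneg fun i _ => hw0 _
  split_ifs
  · rw [Real.norm_eq_abs, abs_mul, abs_of_nonneg hp]
    exact mul_le_mul_of_nonneg_right (hF z) hp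
  · simpa using mul_nonneg ((abs_nonneg _).trans (hF z)) hp

/-- Adding particle `0` as a fixed point: it chooses its mode freely. -/
theorem cycleTrace_insert_fixed {w : ι → ℝ} (hw0 : ∀ k, 0 ≤ w k) (hw : Summable w) {N : ℕ}
    (e : Perm (Fin N)) {f : ι → ℝ} (hf : Summable fun k => f k * w k) :
    cycleTrace w (Perm.decomposeFin.symm (0, e)) (fun z => f (z 0)) =
      (∑' k, f k * w k) * cycleTrace w e (fun _ => 1) := by
  classical
  unfold cycleTrace
  rw [tsum_mul_tsum_of_summable_norm hf.norm
    (summable_cycleTrace hw0 hw e (C := 1) (by simp)).norm,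
    ← (Fin.consEquiv (fun _ => ι)).tsum_eq]
  refine tsum_congr fun x => ?_
  have : (∀ i, (Fin.consEquiv (fun _ => ι) x : Fin (N + 1) → ι)
      (Perm.decomposeFin.symm (0, e) i) = (Fin.consEquiv (fun _ => ι) x : Fin (N + 1) → ι) i) ↔
      ∀ i, x.2 (e i) = x.2 i := by
    rw [Fin.forall_fin_succ]
    simp [Fin.consEquiv]
  simp only [this]
  split_ifs
  · simp [Fin.consEquiv, Fin.prod_univ_succ, mul_assoc]
  · simp

/-- Inserting particle `0` into the cycle of particle `q`: it occupies the same mode, so its weight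
may be absorbed into the observable of particle `q`. -/
theorem cycleTrace_insert_succ (w : ι → ℝ) {N : ℕ} (e : Perm (Fin N)) (q : Fin N) (f : ι → ℝ) :
    cycleTrace w (Perm.decomposeFin.symm (q.succ, e)) (fun z => f (z 0)) =
      cycleTrace w e (fun z => f (z q) * w (z q)) := by
  classical
  unfold cycleTrace
  have hinj : Function.Injective
      (fun y : Fin N → ι => (Fin.cons (y q) y : Fin (N + 1) → ι)) := fun y y' h =>
    (Fin.cons_injective2 h).2
  have key : ∀ z : Fin (N + 1) → ι,
      (∀ i, z (Perm.decomposeFin.symm (q.succ, e) i) = z i) ↔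
        z 0 = z q.succ ∧ ∀ i : Fin N, z (e i).succ = z i.succ := by
    intro z
    rw [Fin.forall_fin_succ]
    simp only [Perm.decomposeFin_symm_apply_zero, Perm.decomposeFin_symm_apply_succ]
    constructor
    · rintro ⟨h0, h⟩
      refine ⟨h0.symm, fun i => ?_⟩
      have := h i
      by_cases hi : e i = q
      · rw [hi, swap_apply_right] at this
        rw [hi, h0, this]
      · rwa [swap_apply_of_ne_of_ne (Fin.succ_ne_zero _)
          (fun h => hi (Fin.succ_injective _ h))] at this
    · rintro ⟨h0, h⟩
      refine ⟨h0.symm, fun i => ?_⟩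
      by_cases hi : e i = q
      · rw [hi, swap_apply_right, h0, ← hi, h i]
      · rw [swap_apply_of_ne_of_ne (Fin.succ_ne_zero _)
          (fun h => hi (Fin.succ_injective _ h)), h i]
  rw [← hinj.tsum_eq]
  · refine tsum_congr fun y => ?_
    simp only [key]
    simp [Fin.prod_univ_succ, mul_assoc]
  · intro z hz
    rw [Function.mem_support] at hz
    have h : z 0 = z q.succ := by
      by_contra h
      exact hz (if_neg fun h' => h ((key z).1 h').1)
    exact ⟨Fin.tail z, by
      simp only [Fin.tail, ← h]
      exact Fin.cons_self_tail z⟩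

theorem cycleTrace_conj (w : ι → ℝ) {N : ℕ} (σ π : Perm (Fin N)) (f : ι → ℝ) (p : Fin N) :
    cycleTrace w (σ * π * σ⁻¹) (fun z => f (z (σ p))) = cycleTrace w π (fun z => f (z p)) := by
  classical
  unfold cycleTrace
  rw [← (Equiv.arrowCongr σ (Equiv.refl ι)).tsum_eq]
  refine tsum_congr fun z => ?_
  have h1 : (∀ i, (Equiv.arrowCongr σ (Equiv.refl ι)) z ((σ * π * σ⁻¹) i) =
      (Equiv.arrowCongr σ (Equiv.refl ι)) z i) ↔ ∀ i, z (π i) = z i := by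
    rw [← σ.forall_congr_right]
    simp [Equiv.arrowCongr]
  have h2 : ∏ i, w ((Equiv.arrowCongr σ (Equiv.refl ι)) z i) = ∏ i, w (z i) := by
    rw [← Equiv.prod_comp σ]
    simp [Equiv.arrowCongr]
  simp only [h1, h2]
  simp [Equiv.arrowCongr]

theorem minimalPeriod_conj {N : ℕ} (σ π : Perm (Fin N)) (p : Fin N) :
    Function.minimalPeriod (σ * π * σ⁻¹) (σ p) = Function.minimalPeriod π p := by
  rw [Function.minimalPeriod_eq_minimalPeriod_iff]
  intro n
  have : (⇑(σ * π * σ⁻¹))^[n] (σ p) = σ (π^[n] p) := by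
    have h : Function.Semiconj (⇑σ) (⇑π) (⇑(σ * π * σ⁻¹)) := fun x => by
      simp [Perm.mul_apply]
    exact ((h.iterate_right n) p).symm
  rw [Function.IsPeriodicPt, Function.IsFixedPt, this, σ.injective.eq_iff]
  rfl

theorem minimalPeriod_perm_pos {N : ℕ} (π : Perm (Fin N)) (p : Fin N) :
    0 < Function.minimalPeriod π p :=
  Function.minimalPeriod_pos_of_mem_periodicPts
    (Function.Injective.mem_periodicPts π.injective p)

theorem minimalPeriod_insert_fixed {N : ℕ} (e : Perm (Fin N)) :
    Function.minimalPeriod (Perm.decomposeFin.symm (0, e)) 0 = 1 := by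
  rw [Function.minimalPeriod_eq_one_iff_isFixedPt]
  exact Perm.decomposeFin_symm_apply_zero 0 e

/-- Inserting a particle into a cycle makes the cycle longer by one: before it returns, the orbit of
`0` under the new permutation is the orbit of `q` under `e`. -/
theorem minimalPeriod_insert_succ {N : ℕ} (e : Perm (Fin N)) (q : Fin N) :
    Function.minimalPeriod (Perm.decomposeFin.symm (q.succ, e)) 0 =
      Function.minimalPeriod e q + 1 := by
  set σ := Perm.decomposeFin.symm (q.succ, e) with hσ
  have hm := minimalPeriod_perm_pos e q
  have key : ∀ k, k < Function.minimalPeriod e q → σ^[k + 1] 0 = (e^[k] q).succ := by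
    intro k
    induction k with
    | zero => intro _; simp [hσ]
    | succ k ih =>
      intro hk
      rw [Function.iterate_succ_apply', ih (by omega), hσ, Perm.decomposeFin_symm_apply_succ,
        ← Function.iterate_succ_apply' e]
      refine swap_apply_of_ne_of_ne (Fin.succ_ne_zero _) fun h => ?_
      exact Function.not_isPeriodicPt_of_pos_of_lt_minimalPeriod (Nat.succ_ne_zero k) hk
        (Fin.succ_injective _ h)
  have hper : Function.IsPeriodicPt σ (Function.minimalPeriod e q + 1) 0 := by
    obtain ⟨m, hm'⟩ : ∃ m, Function.minimalPeriod e q = m + 1 := ⟨_, (Nat.sub_add_cancel hm).symm⟩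
    have h := Function.iterate_minimalPeriod (f := e) (x := q)
    rw [hm', Function.iterate_succ_apply'] at h
    rw [Function.IsPeriodicPt, Function.IsFixedPt, Function.iterate_succ_apply', hm',
      key m (by omega), hσ, Perm.decomposeFin_symm_apply_succ, h, swap_apply_right]
  refine le_antisymm (hper.minimalPeriod_le (Nat.succ_pos _)) ?_
  by_contra! hlt
  have hpos := minimalPeriod_perm_pos σ 0
  obtain ⟨k, hk⟩ : ∃ k, Function.minimalPeriod σ 0 = k + 1 := ⟨_, (Nat.sub_add_cancel hpos).symm⟩
  have h := Function.iterate_minimalPeriod (f := σ) (x := 0)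
  rw [hk, key k (by omega)] at h
  exact Fin.succ_ne_zero _ h

/-- The canonical partition function of `N` free bosons whose modes have Boltzmann factors `w`. -/
def bosonZ (w : ι → ℝ) (N : ℕ) : ℝ :=
  1 / (N.factorial : ℝ) * ∑ π : Perm (Fin N), cycleTrace w π (fun _ => 1)

/-- The part of the permutation sum in which particle `p` lies in a cycle of length `n`, with an
observable `f` of the mode occupied by that particle. -/
def markedSum (w : ι → ℝ) (N : ℕ) (p : Fin N) (n : ℕ) (f : ι → ℝ) : ℝ :=
  ∑ π : Perm (Fin N),
    if Function.minimalPeriod π p = n then cycleTrace w π (fun z => f (z p)) else 0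

theorem markedSum_congr_particle (w : ι → ℝ) {N : ℕ} (p q : Fin N) (n : ℕ) (f : ι → ℝ) :
    markedSum w N p n f = markedSum w N q n f := by
  unfold markedSum
  rw [← Equiv.sum_comp (MulAut.conj (swap q p)).toEquiv]
  refine Finset.sum_congr rfl fun π _ => ?_
  have h1 := minimalPeriod_conj (swap q p) π q
  have h2 := cycleTrace_conj w (swap q p) π f q
  rw [swap_apply_left] at h1 h2
  exact if_congr (by rw [← h1]; rfl) h2 rfl

theorem sum_cycleTrace_one (w : ι → ℝ) (N : ℕ) :
    ∑ π : Perm (Fin N), cycleTrace w π (fun _ => 1) = N.factorial * bosonZ w N := by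
  have : (N.factorial : ℝ) ≠ 0 := by positivity
  unfold bosonZ
  field_simp

/-- A marked cycle of length `n + 1` contributes `∑ f w ^ (n + 1)` and a gas of the remaining
particles. The proof removes the particles of the cycle one by one; it is to carry the Boltzmann
factors of the removed particles that a general observable `f` is needed. -/
theorem markedSum_eq {w : ι → ℝ} (hw0 : ∀ k, 0 ≤ w k) (hw1 : ∀ k, w k ≤ 1) (hw : Summable w)
    (n : ℕ) : ∀ {N : ℕ} (p : Fin (N + 1)) {f : ι → ℝ}, n ≤ N → (∀ k, |f k| ≤ 1) →
      markedSum w (N + 1) p (n + 1) f =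
        N.factorial * bosonZ w (N - n) * ∑' k, f k * w k ^ (n + 1) := by
  induction n with
  | zero =>
    intro N p f _ hf
    have hfw : Summable fun k => f k * w k := by
      refine Summable.of_norm_bounded hw fun k => ?_
      rw [Real.norm_eq_abs, abs_mul, abs_of_nonneg (hw0 k)]
      exact mul_le_of_le_one_left (hw0 k) (hf k)
    rw [markedSum_congr_particle w p 0]
    unfold markedSum
    rw [← Equiv.sum_comp Perm.decomposeFin.symm, Fintype.sum_prod_type, Fin.sum_univ_succ]
    simp only [minimalPeriod_insert_fixed, minimalPeriod_insert_succ,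
      cycleTrace_insert_fixed hw0 hw _ hfw]
    have : ∀ (q : Fin N) (e : Perm (Fin N)), Function.minimalPeriod e q + 1 ≠ 0 + 1 :=
      fun q e h => (minimalPeriod_perm_pos e q).ne' (by omega)
    simp only [this, if_false, Finset.sum_const_zero, add_zero, zero_add, if_true, ← Finset.mul_sum,
      sum_cycleTrace_one, pow_one, Nat.sub_zero]
    ring
  | succ n ih =>
    intro N p f hn hf
    obtain ⟨N, rfl⟩ : ∃ M, N = M + 1 := ⟨N - 1, by omega⟩
    have hf' : ∀ k, |f k * w k| ≤ 1 := fun k => by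
      rw [abs_mul, abs_of_nonneg (hw0 k)]
      exact mul_le_one₀ (hf k) (hw0 k) (hw1 k)
    rw [markedSum_congr_particle w p 0]
    unfold markedSum
    rw [← Equiv.sum_comp Perm.decomposeFin.symm, Fintype.sum_prod_type, Fin.sum_univ_succ]
    simp only [minimalPeriod_insert_fixed, minimalPeriod_insert_succ, cycleTrace_insert_succ]
    have h0 : (1 : ℕ) ≠ n + 1 + 1 := by omega
    simp only [h0, if_false, Finset.sum_const_zero, zero_add, add_left_inj]
    have h1 : ∀ q : Fin (N + 1), (∑ e : Perm (Fin (N + 1)),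
        if Function.minimalPeriod e q = n + 1 then
          cycleTrace w e (fun z => f (z q) * w (z q)) else 0) =
        N.factorial * bosonZ w (N - n) * ∑' k, f k * w k * w k ^ (n + 1) := fun q =>
      ih q (f := fun k => f k * w k) (by omega) hf'
    simp only [h1, Finset.sum_const, Finset.card_univ, Fintype.card_fin, nsmul_eq_mul,
      Nat.add_sub_add_right, Nat.factorial_succ, Nat.cast_mul]
    have h2 : ∀ k, f k * w k * w k ^ (n + 1) = f k * w k ^ (n + 1 + 1) := fun k => by ring
    simp only [h2]
    ring

theorem bosonZ_zero (w : ι → ℝ) : bosonZ w 0 = 1 := by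
  simp [bosonZ, cycleTrace]

/-- The permutation sum with an observable `g` of the length of the cycle of particle `p` and an
observable `f` of the mode it occupies: a cycle of length `n` in the mode `k` contributes `w k ^ n`
and leaves a gas of the remaining particles. -/
theorem sum_cycleTrace_marked {w : ι → ℝ} (hw0 : ∀ k, 0 ≤ w k) (hw1 : ∀ k, w k ≤ 1)
    (hw : Summable w) {N : ℕ} (p : Fin (N + 1)) {f : ι → ℝ} (hf : ∀ k, |f k| ≤ 1) (g : ℕ → ℝ) :
    ∑ π : Perm (Fin (N + 1)),
        cycleTrace w π (fun z => g (Function.minimalPeriod π p) * f (z p)) =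
      N.factorial * ∑ n ∈ Finset.range (N + 1),
        g (n + 1) * (bosonZ w (N - n) * ∑' k, f k * w k ^ (n + 1)) := by
  have h1 : ∀ π : Perm (Fin (N + 1)),
      cycleTrace w π (fun z => g (Function.minimalPeriod π p) * f (z p)) =
      ∑ n ∈ Finset.range (N + 1), g (n + 1) *
        if Function.minimalPeriod π p = n + 1 then cycleTrace w π (fun z => f (z p)) else 0 := by
    intro π
    have h1 := minimalPeriod_perm_pos π p
    have h2 : Function.minimalPeriod π p ≤ N + 1 := by
      simpa using Function.minimalPeriod_le_card (f := π) (x := p)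
    rw [Finset.sum_eq_single (Function.minimalPeriod π p - 1)]
    · rw [if_pos (by omega), Nat.sub_add_cancel h1]
      unfold cycleTrace
      rw [← tsum_mul_left]
      refine tsum_congr fun z => ?_
      split_ifs <;> simp [mul_assoc]
    · intro b _ hb
      rw [if_neg (by omega), mul_zero]
    · intro h
      exact absurd (Finset.mem_range.2 (by omega)) h
  rw [Finset.sum_congr rfl fun π _ => h1 π, Finset.sum_comm, Finset.mul_sum]
  refine Finset.sum_congr rfl fun n hn => ?_
  rw [← Finset.mul_sum]
  have := markedSum_eq hw0 hw1 hw n p (Nat.lt_succ_iff.1 (Finset.mem_range.1 hn)) hf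
  unfold markedSum at this
  rw [this]
  ring

theorem bosonZ_recursion {w : ι → ℝ} (hw0 : ∀ k, 0 ≤ w k) (hw1 : ∀ k, w k ≤ 1)
    (hw : Summable w) (N : ℕ) :
    ((N : ℝ) + 1) * bosonZ w (N + 1) =
      ∑ n ∈ Finset.range (N + 1), (∑' k, w k ^ (n + 1)) * bosonZ w (N - n) := by
  have h := sum_cycleTrace_marked hw0 hw1 hw (0 : Fin (N + 1)) (f := fun _ => 1) (by simp)
    (fun _ => 1)
  simp only [one_mul] at h
  rw [sum_cycleTrace_one] at h
  have hN : (N.factorial : ℝ) ≠ 0 := by positivity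
  rw [Nat.factorial_succ] at h
  push_cast at h
  refine mul_left_cancel₀ hN (Eq.trans (by ring) (h.trans ?_))
  exact congrArg _ (Finset.sum_congr rfl fun n _ => mul_comm _ _)

end PermutationSums

/-! ### Log-concavity of canonical partition functions -/

/-- `Z` behaves like the sequence of canonical partition functions of a free Bose gas with a ground
state of energy zero and with one-particle traces `q n = Tr e^{-nβH₁}`. The value `q 0`, which would
count the modes, plays no role. -/
structure IsBoseSequence (q Z : ℕ → ℝ) : Prop where
  zero : Z 0 = 1
  recursion : ∀ N : ℕ,
    ((N : ℝ) + 1) * Z (N + 1) = ∑ n ∈ Finset.range (N + 1), q (n + 1) * Z (N - n)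
  mono : Monotone Z
  logConcave : ∀ N, Z N * Z (N + 2) ≤ Z (N + 1) ^ 2

namespace IsBoseSequence

variable {q Z : ℕ → ℝ}

theorem pos (h : IsBoseSequence q Z) (N : ℕ) : 0 < Z N :=
  lt_of_lt_of_le (by rw [h.zero]; exact one_pos) (h.mono (Nat.zero_le N))

theorem ratio_le_one (h : IsBoseSequence q Z) (N : ℕ) : Z N / Z (N + 1) ≤ 1 :=
  (div_le_one (h.pos _)).2 (h.mono (Nat.le_succ N))

theorem ratio_nonneg (h : IsBoseSequence q Z) (N : ℕ) : 0 ≤ Z N / Z (N + 1) :=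
  div_nonneg (h.pos _).le (h.pos _).le

theorem ratio_mono (h : IsBoseSequence q Z) : Monotone fun N => Z N / Z (N + 1) := by
  refine monotone_nat_of_le_succ fun N => ?_
  rw [div_le_div_iff₀ (h.pos _) (h.pos _), ← sq]
  exact h.logConcave N

theorem le_ratio_pow_mul (h : IsBoseSequence q Z) {M : ℕ} (n : ℕ) : ∀ {m : ℕ}, m + n ≤ M + 1 →
    Z m ≤ (Z M / Z (M + 1)) ^ n * Z (m + n) := by
  induction n with
  | zero => intro m _; simp
  | succ n ih =>
    intro m hm
    have h1 : Z m / Z (m + 1) ≤ Z M / Z (M + 1) := h.ratio_mono (by omega)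
    rw [div_le_iff₀ (h.pos _)] at h1
    calc Z m ≤ Z M / Z (M + 1) * Z (m + 1) := h1
      _ ≤ Z M / Z (M + 1) * ((Z M / Z (M + 1)) ^ n * Z (m + 1 + n)) :=
        mul_le_mul_of_nonneg_left (ih (by omega)) (h.ratio_nonneg M)
      _ = (Z M / Z (M + 1)) ^ (n + 1) * Z (m + (n + 1)) := by
        rw [show m + (n + 1) = m + 1 + n by ring]; ring

theorem ratio_pow_mul_le (h : IsBoseSequence q Z) {M : ℕ} (n : ℕ) : ∀ {m : ℕ}, M ≤ m →
    (Z M / Z (M + 1)) ^ n * Z (m + n) ≤ Z m := by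
  induction n with
  | zero => intro m _; simp
  | succ n ih =>
    intro m hm
    have h1 : Z M / Z (M + 1) ≤ Z m / Z (m + 1) := h.ratio_mono hm
    rw [le_div_iff₀ (h.pos _)] at h1
    calc (Z M / Z (M + 1)) ^ (n + 1) * Z (m + (n + 1))
        = Z M / Z (M + 1) * ((Z M / Z (M + 1)) ^ n * Z (m + 1 + n)) := by
          rw [show m + (n + 1) = m + 1 + n by ring]; ring
      _ ≤ Z M / Z (M + 1) * Z (m + 1) :=
        mul_le_mul_of_nonneg_left (ih (by omega)) (h.ratio_nonneg M)
      _ ≤ Z m := h1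

/-- Adding one mode with Boltzmann factor `c`: the generating function of `Z` is multiplied by
`1 / (1 - c X)`. -/
theorem add_mode (h : IsBoseSequence q Z) {c : ℝ} (hc : 0 ≤ c) :
    ∃ V, IsBoseSequence (fun n => q n + c ^ n) V := by
  obtain ⟨V, hV0, hV⟩ : ∃ V : ℕ → ℝ, V 0 = 1 ∧ ∀ N, V (N + 1) = Z (N + 1) + c * V N :=
    ⟨fun N => Nat.rec 1 (fun N v => Z (N + 1) + c * v) N, rfl, fun N => rfl⟩
  have hpos : ∀ N, 0 < V N := by
    intro N
    induction N with
    | zero => rw [hV0]; exact one_pos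
    | succ N ih => rw [hV]; exact add_pos_of_pos_of_nonneg (h.pos _) (mul_nonneg hc ih.le)
  refine ⟨V, hV0, ?_, monotone_nat_of_le_succ ?_, ?_⟩
  · intro N
    -- both sides are expanded by `V (N + 1) = Z (N + 1) + c * V N`
    have hsplit : ∀ N, ∑ n ∈ Finset.range (N + 1 + 1), q (n + 1) * V (N + 1 - n) =
        ∑ n ∈ Finset.range (N + 1 + 1), q (n + 1) * Z (N + 1 - n) +
          c * ∑ n ∈ Finset.range (N + 1), q (n + 1) * V (N - n) := by
      intro N
      rw [Finset.sum_range_succ, Finset.sum_range_succ _ (N + 1), Finset.mul_sum]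
      have : ∀ n ∈ Finset.range (N + 1), q (n + 1) * V (N + 1 - n) =
          q (n + 1) * Z (N + 1 - n) + c * (q (n + 1) * V (N - n)) := by
        intro n hn
        rw [Finset.mem_range] at hn
        rw [show N + 1 - n = N - n + 1 by omega, hV]
        ring
      rw [Finset.sum_congr rfl this, Finset.sum_add_distrib]
      simp only [Nat.sub_self, hV0, h.zero]
      ring
    induction N with
    | zero =>
      have := h.recursion 0
      simp [hV, hV0, h.zero] at this ⊢
      linarith
    | succ N ih =>
      have hZ := h.recursion (N + 1)
      have hgeom : ∑ n ∈ Finset.range (N + 1 + 1), c ^ (n + 1) * V (N + 1 - n) =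
          c * V (N + 1) + c * ∑ n ∈ Finset.range (N + 1), c ^ (n + 1) * V (N - n) := by
        rw [Finset.sum_range_succ', Finset.mul_sum, add_comm]
        simp only [Nat.add_sub_add_right, zero_add, pow_one, Nat.sub_zero]
        exact congrArg _ (Finset.sum_congr rfl fun n _ => by ring)
      simp only [add_mul, Finset.sum_add_distrib] at ih ⊢
      rw [hsplit, hgeom, ← hZ, hV (N + 1)]
      push_cast at ih ⊢
      linear_combination c * ih
  · intro N
    induction N with
    | zero =>
      have := h.mono (Nat.zero_le 1)
      rw [h.zero] at this
      rw [hV, hV0]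
      simp only [zero_add, mul_one]
      linarith
    | succ N ih =>
      rw [hV, hV]
      exact add_le_add (h.mono (Nat.le_succ _)) (mul_le_mul_of_nonneg_left ih hc)
  -- log-concavity of `V` reduces to a mixed inequality between `V` and `Z`
  · have key : ∀ N, V N * Z (N + 2) ≤ V (N + 1) * Z (N + 1) := by
      intro N
      induction N with
      | zero =>
        have h1 := h.logConcave 0
        have h2 := mul_nonneg hc (h.pos 1).le
        simp only [zero_add, h.zero] at h1
        rw [hV, hV0]
        simp only [zero_add]
        nlinarith
      | succ N ih =>
        have h1 := h.logConcave (N + 1)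
        have h2 : V N * Z (N + 3) ≤ V (N + 1) * Z (N + 2) := by
          refine le_of_mul_le_mul_right ?_ (h.pos (N + 1))
          calc V N * Z (N + 3) * Z (N + 1) = V N * (Z (N + 1) * Z (N + 1 + 2)) := by ring_nf
            _ ≤ V N * Z (N + 1 + 1) ^ 2 := mul_le_mul_of_nonneg_left h1 (hpos N).le
            _ = V N * Z (N + 2) * Z (N + 2) := by ring_nf
            _ ≤ V (N + 1) * Z (N + 1) * Z (N + 2) := mul_le_mul_of_nonneg_right ih (h.pos _).le
            _ = V (N + 1) * Z (N + 2) * Z (N + 1) := by ring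
        calc V (N + 1) * Z (N + 1 + 2) = Z (N + 1) * Z (N + 1 + 2) + c * (V N * Z (N + 3)) := by
              rw [hV]; ring_nf
          _ ≤ Z (N + 1 + 1) ^ 2 + c * (V (N + 1) * Z (N + 2)) :=
            add_le_add h1 (mul_le_mul_of_nonneg_left h2 hc)
          _ = V (N + 1 + 1) * Z (N + 1 + 1) := by rw [hV (N + 1)]; ring_nf
    intro N
    calc V N * V (N + 2) = V N * Z (N + 2) + c * V N * V (N + 1) := by rw [hV (N + 1)]; ring_nf
      _ ≤ V (N + 1) * Z (N + 1) + c * V N * V (N + 1) := add_le_add_left (key N) _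
      _ = V (N + 1) ^ 2 := by rw [hV N]; ring

/-- Finitely many modes: the ground state `i₀` alone has `Z = 1`, and the other modes are added one
after the other. -/
theorem exists_finset {ι : Type*} {w : ι → ℝ} (hw0 : ∀ k, 0 ≤ w k) {i₀ : ι} (hi₀ : w i₀ = 1)
    (s : Finset ι) (hs : i₀ ∈ s) : ∃ V, IsBoseSequence (fun n => ∑ k ∈ s, w k ^ n) V := by
  classical
  have main : ∀ t : Finset ι, ∃ V, IsBoseSequence (fun n => 1 + ∑ k ∈ t, w k ^ n) V := by
    intro t
    induction t using Finset.induction_on with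
    | empty =>
      refine ⟨fun _ => 1, rfl, fun N => ?_, monotone_const, fun N => by simp⟩
      simp
    | insert a t ha ih =>
      obtain ⟨V, hV⟩ := ih
      obtain ⟨V', hV'⟩ := hV.add_mode (hw0 a)
      refine ⟨V', ?_⟩
      convert hV' using 2 with n
      rw [Finset.sum_insert ha]
      ring
  obtain ⟨V, hV⟩ := main (s.erase i₀)
  refine ⟨V, ?_⟩
  convert hV using 2 with n
  rw [← Finset.add_sum_erase s _ hs, hi₀, one_pow]

end IsBoseSequence

section Truncation

variable {ι : Type*}

theorem summable_pow_succ {w : ι → ℝ} (hw0 : ∀ k, 0 ≤ w k) (hw1 : ∀ k, w k ≤ 1)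
    (hw : Summable w) (n : ℕ) : Summable fun k => w k ^ (n + 1) :=
  Summable.of_nonneg_of_le (fun k => pow_nonneg (hw0 k) _)
    (fun k => by
      rw [pow_succ]
      exact mul_le_of_le_one_left (hw0 k) (pow_le_one₀ (hw0 k) (hw1 k))) hw

/-- Monotonicity and log-concavity pass from finitely many modes to all modes, because by the
recursion each partition function is a continuous function of the one-particle traces. -/
theorem isBoseSequence_bosonZ {w : ι → ℝ} (hw0 : ∀ k, 0 ≤ w k) (hw1 : ∀ k, w k ≤ 1)
    (hw : Summable w) {i₀ : ι} (hi₀ : w i₀ = 1) :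
    IsBoseSequence (fun n => ∑' k, w k ^ n) (bosonZ w) := by
  classical
  have hex : ∀ s : Finset ι, ∃ V, i₀ ∈ s → IsBoseSequence (fun n => ∑ k ∈ s, w k ^ n) V := by
    intro s
    by_cases hs : i₀ ∈ s
    · obtain ⟨V, hV⟩ := IsBoseSequence.exists_finset hw0 hi₀ s hs
      exact ⟨V, fun _ => hV⟩
    · exact ⟨fun _ => 0, fun h => absurd h hs⟩
  choose U hU using hex
  have hev : ∀ᶠ s : Finset ι in atTop, i₀ ∈ s :=
    (eventually_ge_atTop {i₀}).mono fun s hs => hs (Finset.mem_singleton_self i₀)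
  have hlim : ∀ N, Tendsto (fun s => U s N) atTop (𝓝 (bosonZ w N)) := by
    intro N
    induction N using Nat.strong_induction_on with
    | _ N ih =>
      cases N with
      | zero =>
        rw [bosonZ_zero]
        exact tendsto_const_nhds.congr' (hev.mono fun s hs => (hU s hs).zero.symm)
      | succ N =>
        have hN : (N : ℝ) + 1 ≠ 0 := by positivity
        have h1 : bosonZ w (N + 1) = (∑ n ∈ Finset.range (N + 1),
            (∑' k, w k ^ (n + 1)) * bosonZ w (N - n)) / ((N : ℝ) + 1) := by
          rw [← bosonZ_recursion hw0 hw1 hw]; field_simp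
        rw [h1]
        have h2 : Tendsto (fun s : Finset ι => (∑ n ∈ Finset.range (N + 1),
            (∑ k ∈ s, w k ^ (n + 1)) * U s (N - n)) / ((N : ℝ) + 1)) atTop
            (𝓝 ((∑ n ∈ Finset.range (N + 1),
            (∑' k, w k ^ (n + 1)) * bosonZ w (N - n)) / ((N : ℝ) + 1))) :=
          (tendsto_finsetSum _ fun n _ =>
            Tendsto.mul (summable_pow_succ hw0 hw1 hw n).hasSum (ih _ (by omega))).div_const _
        refine h2.congr' (hev.mono fun s hs => ?_)
        rw [← (hU s hs).recursion]
        field_simp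
  refine ⟨bosonZ_zero w, bosonZ_recursion hw0 hw1 hw, fun M N hMN => ?_, fun N => ?_⟩
  · exact le_of_tendsto_of_tendsto (hlim M) (hlim N) (hev.mono fun s hs => (hU s hs).mono hMN)
  · exact le_of_tendsto_of_tendsto ((hlim _).mul (hlim _)) ((hlim _).pow 2)
      (hev.mono fun s hs => (hU s hs).logConcave N)

end Truncation

/-! ### Theta series and the gas on the torus -/

/-- The theta series `∑_{n ∈ ℤ} e^{-π t n²}`. -/
def theta (t : ℝ) : ℝ := ∑' n : ℤ, Real.exp (-Real.pi * t * (n : ℝ) ^ 2)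

theorem exp_neg_sq_le_pow {t : ℝ} (ht : 0 < t) (n : ℕ) :
    Real.exp (-Real.pi * t * ((n : ℝ) + 1) ^ 2) ≤ Real.exp (-Real.pi * t) ^ (n + 1) := by
  rw [← Real.exp_nat_mul, Real.exp_le_exp]
  have h1 : 0 < Real.pi * t := mul_pos Real.pi_pos ht
  have h2 : (0 : ℝ) ≤ n := Nat.cast_nonneg n
  push_cast
  nlinarith [mul_nonneg h1.le (mul_nonneg h2 (by linarith : (0 : ℝ) ≤ n + 1))]

/-- The theta series as one plus twice its convergent half. -/
theorem hasSum_theta {t : ℝ} (ht : 0 < t) :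
    Summable (fun n : ℕ => Real.exp (-Real.pi * t * ((n : ℝ) + 1) ^ 2)) ∧
    HasSum (fun n : ℤ => Real.exp (-Real.pi * t * (n : ℝ) ^ 2))
      (1 + 2 * ∑' n : ℕ, Real.exp (-Real.pi * t * ((n : ℝ) + 1) ^ 2)) := by
  have h1 : 0 < Real.pi * t := mul_pos Real.pi_pos ht
  have hr : Real.exp (-Real.pi * t) < 1 := by rw [Real.exp_lt_one_iff]; linarith
  have hs : Summable (fun n : ℕ => Real.exp (-Real.pi * t * ((n : ℝ) + 1) ^ 2)) :=
    Summable.of_nonneg_of_le (fun n => (Real.exp_pos _).le) (exp_neg_sq_le_pow ht)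
      ((summable_nat_add_iff 1).2 (summable_geometric_of_lt_one (Real.exp_pos _).le hr))
  refine ⟨hs, ?_⟩
  set f : ℤ → ℝ := fun n => Real.exp (-Real.pi * t * (n : ℝ) ^ 2) with hf
  set S : ℝ := ∑' n : ℕ, Real.exp (-Real.pi * t * ((n : ℝ) + 1) ^ 2) with hS
  have h3 : HasSum (fun n : ℕ => f (n + 1)) S := by
    have : (fun n : ℕ => f (n + 1)) =
        fun n : ℕ => Real.exp (-Real.pi * t * ((n : ℝ) + 1) ^ 2) := by
      funext n
      simp only [hf]
      push_cast
      rfl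
    rw [this]
    exact hs.hasSum
  have h4 : HasSum (fun n : ℕ => f (-(n + 1))) S := by
    have : (fun n : ℕ => f (-(n + 1))) = fun n : ℕ => f (n + 1) := by
      funext n
      simp only [hf]
      push_cast
      rw [neg_sq]
    rw [this]
    exact h3
  have h5 : f 0 = 1 := by simp [hf]
  have h6 := HasSum.of_add_one_of_neg_add_one h3 h4
  rwa [h5, show S + 1 + S = 1 + 2 * S by ring] at h6

theorem summable_theta {t : ℝ} (ht : 0 < t) :
    Summable (fun n : ℤ => Real.exp (-Real.pi * t * (n : ℝ) ^ 2)) :=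
  (hasSum_theta ht).2.summable

theorem one_le_theta {t : ℝ} (ht : 0 < t) : 1 ≤ theta t := by
  rw [theta, (hasSum_theta ht).2.tsum_eq]
  have : 0 ≤ ∑' n : ℕ, Real.exp (-Real.pi * t * ((n : ℝ) + 1) ^ 2) :=
    tsum_nonneg fun n => (Real.exp_pos _).le
  linarith

theorem theta_antitoneOn : AntitoneOn theta (Set.Ioi 0) := by
  intro s hs t ht hst
  refine (summable_theta ht).tsum_le_tsum (fun n => ?_) (summable_theta hs)
  rw [Real.exp_le_exp]
  have := mul_nonneg (mul_nonneg Real.pi_pos.le (sub_nonneg.2 hst)) (sq_nonneg (n : ℝ))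
  linarith

theorem theta_le_one_add_inv {t : ℝ} (ht : 0 < t) : theta t ≤ 1 + 1 / t := by
  rw [theta, (hasSum_theta ht).2.tsum_eq]
  have h1 : 0 < Real.pi * t := mul_pos Real.pi_pos ht
  set r := Real.exp (-Real.pi * t) with hr0
  have hrpos : 0 < r := Real.exp_pos _
  have hr : r < 1 := by rw [hr0, Real.exp_lt_one_iff]; linarith
  have hg : HasSum (fun n : ℕ => r ^ (n + 1)) (r / (1 - r)) := by
    simp only [pow_succ']
    exact (hasSum_geometric_of_lt_one hrpos.le hr).mul_left r
  have h2 : ∑' n : ℕ, Real.exp (-Real.pi * t * ((n : ℝ) + 1) ^ 2) ≤ r / (1 - r) := by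
    rw [← hg.tsum_eq]
    exact (hasSum_theta ht).1.tsum_le_tsum (exp_neg_sq_le_pow ht) hg.summable
  have h3 : r / (1 - r) ≤ 1 / (2 * t) := by
    rw [div_le_div_iff₀ (by linarith) (by linarith)]
    -- `e^{-πt} (1 + πt) ≤ 1`
    have h4 : Real.exp (Real.pi * t) * r = 1 := by
      rw [hr0, ← Real.exp_add]; simp
    have h5 := Real.add_one_le_exp (Real.pi * t)
    have h6 := mul_le_mul_of_nonneg_right h5 hrpos.le
    have h7 : 2 * t ≤ Real.pi * t := mul_le_mul_of_nonneg_right Real.two_le_pi ht.le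
    nlinarith
  have h8 : 2 * (1 / (2 * t)) = 1 / t := by field_simp
  linarith

/-- Poisson summation. -/
theorem sqrt_mul_theta {t : ℝ} (ht : 0 < t) : Real.sqrt t * theta t = theta (1 / t) := by
  have h := Real.tsum_exp_neg_mul_int_sq ht
  rw [← Real.sqrt_eq_rpow] at h
  have h2 : theta (1 / t) = ∑' n : ℤ, Real.exp (-Real.pi / t * (n : ℝ) ^ 2) := by
    unfold theta
    exact tsum_congr fun n => by rw [mul_one_div]
  have h3 : 0 < Real.sqrt t := Real.sqrt_pos.2 ht
  rw [h2, theta, h]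
  field_simp

/-- For `t ≥ 1` the bound follows from `theta t ≤ 1 + 1 / t`; for `t ≤ 1` the same bound is applied
after Poisson summation. -/
theorem theta_le {t : ℝ} (ht : 0 < t) : theta t ≤ 1 + 2 / Real.sqrt t := by
  have h3 : 0 < Real.sqrt t := Real.sqrt_pos.2 ht
  have h4 : Real.sqrt t * Real.sqrt t = t := Real.mul_self_sqrt ht.le
  rcases le_total 1 t with h | h
  · have h5 : 1 ≤ Real.sqrt t := Real.one_le_sqrt.2 h
    refine (theta_le_one_add_inv ht).trans (add_le_add_right ?_ 1)
    rw [div_le_div_iff₀ ht h3]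
    nlinarith
  · have h5 := theta_le_one_add_inv (one_div_pos.2 ht)
    rw [← sqrt_mul_theta ht, one_div_one_div] at h5
    have h6 : theta t ≤ 2 / Real.sqrt t := by
      rw [le_div_iff₀ h3]; linarith
    linarith

theorem tendsto_sqrt_mul_theta :
    Tendsto (fun t => Real.sqrt t * theta t) (𝓝[>] 0) (𝓝 1) := by
  have h1 : Tendsto (fun t : ℝ => 1 + t) (𝓝[>] 0) (𝓝 1) := by
    have : Tendsto (fun t : ℝ => 1 + t) (𝓝 0) (𝓝 (1 + 0)) := tendsto_const_nhds.add tendsto_id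
    rw [add_zero] at this
    exact this.mono_left nhdsWithin_le_nhds
  refine tendsto_of_tendsto_of_tendsto_of_le_of_le' tendsto_const_nhds h1 ?_ ?_
  · filter_upwards [self_mem_nhdsWithin] with t ht
    rw [sqrt_mul_theta ht]
    exact one_le_theta (one_div_pos.2 ht)
  · filter_upwards [self_mem_nhdsWithin] with t ht
    rw [sqrt_mul_theta ht]
    simpa using theta_le_one_add_inv (one_div_pos.2 (Set.mem_Ioi.1 ht))

/-- The one-particle trace `Tr e^{-nβH₁}` on the torus of side `L`, as a function of the thermal
wave length `Λ` at inverse temperature `β`. -/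
def boxTrace (d : ℕ) (Λ L : ℝ) (n : ℕ) : ℝ := theta (n * Λ ^ 2 / L ^ 2) ^ d

theorem sqrt_pow_eq_rpow (d : ℕ) {x : ℝ} (hx : 0 ≤ x) : Real.sqrt x ^ d = x ^ ((d : ℝ) / 2) := by
  rw [Real.sqrt_eq_rpow, ← Real.rpow_natCast, ← Real.rpow_mul hx]
  congr 1
  ring

section BoxTrace

variable {d : ℕ} {Λ L : ℝ} {n : ℕ}

theorem one_le_boxTrace (hΛ : 0 < Λ) (hL : 0 < L) (hn : 0 < n) : 1 ≤ boxTrace d Λ L n :=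
  one_le_pow₀ (one_le_theta (by positivity))

theorem boxTrace_le_one_trace (hΛ : 0 < Λ) (hL : 0 < L) (hn : 0 < n) :
    boxTrace d Λ L n ≤ boxTrace d Λ L 1 := by
  have h1 : (1 : ℝ) ≤ n := by exact_mod_cast hn
  refine pow_le_pow_left₀ (zero_le_one.trans (one_le_theta (by positivity))) ?_ d
  refine theta_antitoneOn (Set.mem_Ioi.2 (by positivity)) (Set.mem_Ioi.2 (by positivity)) ?_
  simp only [Nat.cast_one]
  gcongr

theorem sqrt_scale (hΛ : 0 < Λ) (hL : 0 < L) :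
    Real.sqrt (n * Λ ^ 2 / L ^ 2) = Real.sqrt n * Λ / L := by
  rw [Real.sqrt_div (by positivity), Real.sqrt_mul (by positivity), Real.sqrt_sq hΛ.le,
    Real.sqrt_sq hL.le]

theorem one_add_two_mul_pow_le {u : ℝ} (hu : 0 ≤ u) :
    (1 + 2 * u) ^ d ≤ 1 + 3 ^ d * (u + u ^ d) := by
  rcases le_total u 1 with h | h
  · -- convexity of the power on `[1, 3]`
    have h1 : (1 + 2 * u) ^ d ≤ (1 - u) * 1 ^ d + u * 3 ^ d := by
      have := (convexOn_pow (𝕜 := ℝ) d).2 (Set.mem_Ici.2 zero_le_one)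
        (Set.mem_Ici.2 (by norm_num : (0 : ℝ) ≤ 3)) (sub_nonneg.2 h) hu (by ring)
      simp only [smul_eq_mul] at this
      convert! this using 2
      ring
    have h2 : 0 ≤ (3 : ℝ) ^ d * u ^ d := by positivity
    rw [one_pow] at h1
    nlinarith
  · have h1 : (1 + 2 * u) ^ d ≤ (3 * u) ^ d := pow_le_pow_left₀ (by linarith) (by linarith) d
    rw [mul_pow] at h1
    have h2 : 0 ≤ (3 : ℝ) ^ d * u := by positivity
    nlinarith

/-- The excess of the trace over the ground state contribution `1`: besides the bulk term of order
`L ^ d` only the surface term of order `L` has to be kept. -/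
theorem boxTrace_le (hΛ : 0 < Λ) (hL : 0 < L) (hn : 0 < n) :
    boxTrace d Λ L n ≤
      1 + 3 ^ d * (L / Λ / Real.sqrt n + L ^ d / (Λ ^ d * (n : ℝ) ^ ((d : ℝ) / 2))) := by
  have hn' : (0 : ℝ) < n := Nat.cast_pos.2 hn
  have ht : 0 < n * Λ ^ 2 / L ^ 2 := by positivity
  have hu : 0 ≤ L / Λ / Real.sqrt n := by positivity
  have h1 : theta (n * Λ ^ 2 / L ^ 2) ≤ 1 + 2 * (L / Λ / Real.sqrt n) := by
    have h := theta_le ht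
    rw [sqrt_scale hΛ hL] at h
    refine h.trans (le_of_eq ?_)
    have : 0 < Real.sqrt n := Real.sqrt_pos.2 hn'
    field_simp
  refine (pow_le_pow_left₀ (zero_le_one.trans (one_le_theta ht)) h1 d).trans
    ((one_add_two_mul_pow_le hu).trans (le_of_eq ?_))
  rw [div_pow _ (Real.sqrt n), div_pow, sqrt_pow_eq_rpow d hn'.le, div_div (L ^ d)]

theorem tendsto_boxTrace_div (hΛ : 0 < Λ) (hn : 0 < n) {α : Type*} {l : Filter α} {L : α → ℝ}
    (hL : Tendsto L l atTop) :
    Tendsto (fun i => boxTrace d Λ (L i) n / L i ^ d) l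
      (𝓝 (1 / (Λ ^ d * (n : ℝ) ^ ((d : ℝ) / 2)))) := by
  have hn' : (0 : ℝ) < n := Nat.cast_pos.2 hn
  have hs : 0 < Real.sqrt n := Real.sqrt_pos.2 hn'
  have h1 : Tendsto (fun i => n * Λ ^ 2 / L i ^ 2) l (𝓝[>] 0) := by
    refine tendsto_nhdsWithin_iff.2
      ⟨Tendsto.const_div_atTop ((tendsto_pow_atTop two_ne_zero).comp hL) _, ?_⟩
    filter_upwards [hL.eventually_gt_atTop 0] with i hi
    exact Set.mem_Ioi.2 (by positivity)
  have h2 := (((tendsto_sqrt_mul_theta.comp h1).div_const (Real.sqrt n * Λ)).pow d)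
  have h3 : (1 / (Real.sqrt n * Λ)) ^ d = 1 / (Λ ^ d * (n : ℝ) ^ ((d : ℝ) / 2)) := by
    rw [div_pow, one_pow, mul_pow, sqrt_pow_eq_rpow d hn'.le, mul_comm]
  rw [h3] at h2
  refine h2.congr' ?_
  filter_upwards [hL.eventually_gt_atTop 0] with i hi
  simp only [Function.comp, boxTrace]
  rw [sqrt_scale hΛ hi, ← div_pow]
  congr 1
  field_simp

end BoxTrace

/-- The Boltzmann factor `e^{-βε_k}` of the mode `k = (2π/L) z`. -/
def boltzmann (d : ℕ) (hbar m β L : ℝ) (z : Mode d) : ℝ :=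
  Real.exp (-β * modeEnergy d hbar m L z)

section Boltzmann

variable {d : ℕ} {hbar m β L : ℝ}

theorem thermalLength_pos (hhbar : 0 < hbar) (hm : 0 < m) (hβ : 0 < β) :
    0 < thermalLength hbar m β :=
  Real.sqrt_pos.2 (by have := Real.pi_pos; positivity)

theorem thermalLength_sq (hhbar : 0 < hbar) (hm : 0 < m) (hβ : 0 < β) :
    thermalLength hbar m β ^ 2 = 2 * Real.pi * hbar ^ 2 * β / m :=
  Real.sq_sqrt (by have := Real.pi_pos; positivity)

theorem boltzmann_nonneg (z : Mode d) : 0 ≤ boltzmann d hbar m β L z := (Real.exp_pos _).le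

theorem boltzmann_le_one (hm : 0 < m) (hβ : 0 < β) (z : Mode d) :
    boltzmann d hbar m β L z ≤ 1 := by
  rw [boltzmann, Real.exp_le_one_iff]
  have : 0 ≤ modeEnergy d hbar m L z := by unfold modeEnergy; positivity
  nlinarith

theorem boltzmann_zero : boltzmann d hbar m β L 0 = 1 := by
  simp [boltzmann, modeEnergy]

theorem boltzmann_pow (hhbar : 0 < hbar) (hm : 0 < m) (hβ : 0 < β) (n : ℕ) (z : Mode d) :
    boltzmann d hbar m β L z ^ n = ∏ i,
      Real.exp (-Real.pi * (n * thermalLength hbar m β ^ 2 / L ^ 2) * (z i : ℝ) ^ 2) := by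
  rw [boltzmann, ← Real.exp_nat_mul, ← Real.exp_sum, thermalLength_sq hhbar hm hβ, modeEnergy]
  congr 1
  rw [← Finset.mul_sum]
  simp only [mul_pow]
  rw [← Finset.mul_sum]
  field_simp

theorem hasSum_boltzmann_pow (hhbar : 0 < hbar) (hm : 0 < m) (hβ : 0 < β) (hL : 0 < L) {n : ℕ}
    (hn : 0 < n) :
    HasSum (fun z => boltzmann d hbar m β L z ^ n) (boxTrace d (thermalLength hbar m β) L n) := by
  have hΛ := thermalLength_pos hhbar hm hβ
  have h := hasSum_pi_prod (N := d) (fun _ (k : ℤ) =>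
    Real.exp (-Real.pi * (n * thermalLength hbar m β ^ 2 / L ^ 2) * (k : ℝ) ^ 2))
    (fun _ _ => (Real.exp_pos _).le) (fun _ => summable_theta (by positivity))
  simp only [boltzmann_pow hhbar hm hβ]
  simpa [boxTrace, theta] using h

theorem summable_boltzmann (hhbar : 0 < hbar) (hm : 0 < m) (hβ : 0 < β) (hL : 0 < L) :
    Summable (boltzmann d hbar m β L) := by
  simpa using (hasSum_boltzmann_pow (d := d) hhbar hm hβ hL one_pos).summable

theorem isBoseSequence_boltzmann (hhbar : 0 < hbar) (hm : 0 < m) (hβ : 0 < β) (hL : 0 < L) :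
    IsBoseSequence (boxTrace d (thermalLength hbar m β) L) (bosonZ (boltzmann d hbar m β L)) := by
  have h := isBoseSequence_bosonZ (w := boltzmann d hbar m β L) boltzmann_nonneg
    (boltzmann_le_one hm hβ) (summable_boltzmann hhbar hm hβ hL) boltzmann_zero
  refine ⟨h.zero, fun N => (h.recursion N).trans (Finset.sum_congr rfl fun n _ => ?_), h.mono,
    h.logConcave⟩
  rw [(hasSum_boltzmann_pow hhbar hm hβ hL (Nat.succ_pos n)).tsum_eq]

theorem canonicalSum_eq (N : ℕ) (F : Equiv.Perm (Fin N) → (Fin N → Mode d) → ℝ) :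
    canonicalSum d hbar m β N L F =
      1 / (N.factorial : ℝ) * ∑ π, cycleTrace (boltzmann d hbar m β L) π (F π) := by
  unfold canonicalSum cycleTrace
  congr 1
  refine Finset.sum_congr rfl fun π _ => tsum_congr fun z => ?_
  have : Real.exp (-β * ∑ i, modeEnergy d hbar m L (z i)) =
      ∏ i, boltzmann d hbar m β L (z i) := by
    rw [Finset.mul_sum, Real.exp_sum]
    rfl
  rw [this]
  congr

theorem partitionFunction_eq (N : ℕ) :
    partitionFunction d hbar m β N L = bosonZ (boltzmann d hbar m β L) N :=
  canonicalSum_eq N _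

/-- The law of the length of the cycle of the first particle: a cycle of length `n` contributes the
trace `q_n` and leaves a gas of the other particles. The summation index is the length minus one. -/
theorem cycleProb_eq (hhbar : 0 < hbar) (hm : 0 < m) (hβ : 0 < β) (hL : 0 < L) (N : ℕ)
    (S : Set ℕ) :
    cycleProb d hbar m β (N + 1) L S =
      ∑ n ∈ Finset.range (N + 1), S.indicator 1 (n + 1) *
        (boxTrace d (thermalLength hbar m β) L (n + 1) *
          (bosonZ (boltzmann d hbar m β L) (N - n) /
            ((N + 1) * bosonZ (boltzmann d hbar m β L) (N + 1)))) := by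
  have h := sum_cycleTrace_marked (w := boltzmann d hbar m β L) boltzmann_nonneg
    (boltzmann_le_one hm hβ) (summable_boltzmann hhbar hm hβ hL) (0 : Fin (N + 1))
    (f := fun _ => 1) (by simp) (S.indicator 1)
  simp only [mul_one, one_mul] at h
  unfold cycleProb canonicalExpectation
  rw [canonicalSum_eq, partitionFunction_eq]
  have h2 : ∀ π : Equiv.Perm (Fin (N + 1)), cycleLengthOne π = Function.minimalPeriod π 0 :=
    fun π => by rw [cycleLengthOne, dif_pos (Nat.succ_pos N)]; rfl
  simp only [h2]
  rw [h, Finset.mul_sum, Finset.mul_sum, Finset.sum_div]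
  refine Finset.sum_congr rfl fun n _ => ?_
  rw [(hasSum_boltzmann_pow hhbar hm hβ hL (Nat.succ_pos n)).tsum_eq, Nat.factorial_succ]
  push_cast
  have hZ := (isBoseSequence_boltzmann (d := d) hhbar hm hβ hL).pos (N + 1)
  have hN : (N.factorial : ℝ) ≠ 0 := by positivity
  field_simp

/-- The condensate occupation is the sum of `P(N₀ ≥ n) = Z_{N-n} / Z_N` over `n ≥ 1`; it is obtained
here from the cycles of all particles, restricted to the mode `0`. -/
theorem zeroModeOccupation_eq (hhbar : 0 < hbar) (hm : 0 < m) (hβ : 0 < β) (hL : 0 < L) (N : ℕ) :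
    zeroModeOccupation d hbar m β (N + 1) L =
      ∑ n ∈ Finset.range (N + 1), bosonZ (boltzmann d hbar m β L) (N - n) /
        bosonZ (boltzmann d hbar m β L) (N + 1) := by
  classical
  have hf : ∀ k : Mode d, |(if k = 0 then (1 : ℝ) else 0)| ≤ 1 := fun k => by split_ifs <;> simp
  have h := fun p : Fin (N + 1) => sum_cycleTrace_marked (w := boltzmann d hbar m β L)
    boltzmann_nonneg (boltzmann_le_one hm hβ) (summable_boltzmann hhbar hm hβ hL) p hf (fun _ => 1)
  simp only [one_mul] at h
  have h2 : ∀ n : ℕ, ∑' k : Mode d, (if k = 0 then (1 : ℝ) else 0) *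
      boltzmann d hbar m β L k ^ (n + 1) = 1 := by
    intro n
    rw [tsum_eq_single 0 (fun k hk => by simp [hk])]
    simp [boltzmann_zero]
  simp only [h2, mul_one] at h
  unfold zeroModeOccupation canonicalExpectation
  rw [canonicalSum_eq, partitionFunction_eq]
  have h3 : ∀ π : Equiv.Perm (Fin (N + 1)), cycleTrace (boltzmann d hbar m β L) π
      (fun z => ((Finset.univ.filter (fun i => z i = 0)).card : ℝ)) =
      ∑ p, cycleTrace (boltzmann d hbar m β L) π (fun z => if z p = 0 then (1 : ℝ) else 0) := by
    intro π
    unfold cycleTrace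
    rw [← Summable.tsum_finsetSum fun p _ => summable_cycleTrace boltzmann_nonneg
      (summable_boltzmann hhbar hm hβ hL) π (C := 1) fun z => hf (z p)]
    refine tsum_congr fun z => ?_
    split_ifs
    · rw [← Finset.sum_mul]
      simp
    · simp
  have h4 : ∀ π : Equiv.Perm (Fin (N + 1)), cycleTrace (boltzmann d hbar m β L) π
      (fun z => ((Finset.univ.filter (fun i => z i = 0)).card : ℝ)) = _ := h3
  rw [Finset.sum_congr rfl fun π _ => h4 π, Finset.sum_comm, Finset.sum_congr rfl fun p _ => h p]
  simp only [Finset.sum_const, Finset.card_univ, Fintype.card_fin, nsmul_eq_mul]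
  rw [← Finset.sum_div, Nat.factorial_succ]
  push_cast
  have hZ := (isBoseSequence_boltzmann (d := d) hhbar hm hβ hL).pos (N + 1)
  have hN : (N.factorial : ℝ) ≠ 0 := by positivity
  field_simp

end Boltzmann

/-! ### Convergence of the canonical fugacity -/

/-- The Bose function `g_s(y) = ∑_{n ≥ 1} y^n / n^s`. -/
def boseFunction (s y : ℝ) : ℝ := ∑' n : ℕ, y ^ (n + 1) / ((n + 1 : ℕ) : ℝ) ^ s

section BoseFunction

variable {s y : ℝ}

theorem summable_inv_rpow (hs : 1 < s) : Summable fun n : ℕ => 1 / ((n + 1 : ℕ) : ℝ) ^ s :=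
  (summable_nat_add_iff 1 (f := fun n : ℕ => 1 / (n : ℝ) ^ s)).2
    (Real.summable_one_div_nat_rpow.2 hs)

theorem boseTerm_le (hy0 : 0 ≤ y) (hy1 : y ≤ 1) (n : ℕ) :
    y ^ (n + 1) / ((n + 1 : ℕ) : ℝ) ^ s ≤ 1 / ((n + 1 : ℕ) : ℝ) ^ s :=
  div_le_div_of_nonneg_right (pow_le_one₀ hy0 hy1) (by positivity)

theorem summable_bose (hs : 1 < s) (hy0 : 0 ≤ y) (hy1 : y ≤ 1) :
    Summable fun n : ℕ => y ^ (n + 1) / ((n + 1 : ℕ) : ℝ) ^ s :=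
  Summable.of_nonneg_of_le (fun n => by positivity) (boseTerm_le hy0 hy1) (summable_inv_rpow hs)

theorem boseFunction_strictMonoOn (hs : 1 < s) :
    StrictMonoOn (boseFunction s) (Set.Icc 0 1) := by
  intro a ha b hb hab
  refine Summable.tsum_lt_tsum (i := 0) (fun n => ?_) ?_ (summable_bose hs ha.1 ha.2)
    (summable_bose hs hb.1 hb.2)
  · exact div_le_div_of_nonneg_right (pow_le_pow_left₀ ha.1 hab.le _) (by positivity)
  · simpa using hab

theorem boseFunction_zero : boseFunction s 0 = 0 := by
  simp [boseFunction]

theorem boseFunction_continuousOn (hs : 1 < s) :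
    ContinuousOn (boseFunction s) (Set.Icc 0 1) := by
  refine continuousOn_tsum (fun n => by fun_prop) (summable_inv_rpow hs) fun n y hy => ?_
  have : 0 ≤ y ^ (n + 1) / ((n + 1 : ℕ) : ℝ) ^ s := by have := hy.1; positivity
  rw [Real.norm_of_nonneg this]
  exact boseTerm_le hy.1 hy.2 n

theorem exists_partial_sum_gt (hs : 1 < s) (hy0 : 0 ≤ y) (hy1 : y ≤ 1) {c : ℝ}
    (hc : c < boseFunction s y) :
    ∃ K, c < ∑ n ∈ Finset.range K, y ^ (n + 1) / ((n + 1 : ℕ) : ℝ) ^ s :=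
  (((summable_bose hs hy0 hy1).hasSum.tendsto_sum_nat).eventually_const_lt hc).exists

end BoseFunction

section Ratio

variable {d : ℕ} {Λ : ℝ} {Z : ℝ → ℕ → ℝ} {α : Type*} {l : Filter α} {L : α → ℝ} {M : α → ℕ}
  {ρ x y : ℝ}

theorem tendsto_add_const_density (hd : d ≠ 0) (hL : Tendsto L l atTop)
    (hM : Tendsto (fun i => (M i : ℝ) / L i ^ d) l (𝓝 ρ)) (c : ℝ) :
    Tendsto (fun i => ((M i : ℝ) + c) / L i ^ d) l (𝓝 ρ) := by
  have h : Tendsto (fun i => c / L i ^ d) l (𝓝 0) :=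
    Tendsto.const_div_atTop ((tendsto_pow_atTop hd).comp hL) c
  simpa [add_div] using hM.add h

/-- The grand canonical density of the box, at fixed fugacity `y < 1`, converges to that of the
infinite gas. -/
theorem tendsto_grandCanonical_density (hΛ : 0 < Λ) (hL : Tendsto L l atTop) [l.NeBot]
    (hy0 : 0 ≤ y) (hy1 : y < 1) :
    Tendsto (fun i => ∑' n : ℕ, boxTrace d Λ (L i) (n + 1) / L i ^ d * y ^ (n + 1)) l
      (𝓝 (boseFunction ((d : ℝ) / 2) y / Λ ^ d)) := by
  have h1 := tendsto_boxTrace_div (d := d) hΛ one_pos hL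
  have hC := h1.eventually_le_const (lt_add_one _)
  have h2 : boseFunction ((d : ℝ) / 2) y / Λ ^ d = ∑' n : ℕ,
      1 / (Λ ^ d * ((n + 1 : ℕ) : ℝ) ^ ((d : ℝ) / 2)) * y ^ (n + 1) := by
    rw [boseFunction, ← tsum_div_const]
    exact tsum_congr fun n => by field_simp
  rw [h2]
  refine tendsto_tsum_of_dominated_convergence
    (((summable_nat_add_iff 1).2 (summable_geometric_of_lt_one hy0 hy1)).mul_left
      (1 / (Λ ^ d * ((1 : ℕ) : ℝ) ^ ((d : ℝ) / 2)) + 1)) (fun n => ?_) ?_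
  · exact (tendsto_boxTrace_div hΛ (Nat.succ_pos n) hL).mul_const _
  · filter_upwards [hC, hL.eventually_gt_atTop 0] with i hi hLi n
    have h3 := one_le_boxTrace (d := d) hΛ hLi (Nat.succ_pos n)
    have h4 : 0 ≤ boxTrace d Λ (L i) (n + 1) / L i ^ d := by positivity
    rw [Real.norm_of_nonneg (by positivity)]
    refine mul_le_mul_of_nonneg_right (le_trans ?_ hi) (by positivity)
    exact div_le_div_of_nonneg_right (boxTrace_le_one_trace hΛ hLi (Nat.succ_pos n)) (by positivity)

/-- By log-concavity `Z_{M-n} / Z_{M+1} ≤ a ^ (n + 1)` with `a = Z_M / Z_{M+1}`, so that the grand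
canonical density at fugacity `a` is not below the canonical one. -/
theorem eventually_lt_ratio (hd : d ≠ 0) (hΛ : 0 < Λ)
    (hZ : ∀ L, 0 < L → IsBoseSequence (boxTrace d Λ L) (Z L)) [l.NeBot] (hL : Tendsto L l atTop)
    (hM : Tendsto (fun i => (M i : ℝ) / L i ^ d) l (𝓝 ρ)) (hy0 : 0 ≤ y) (hy1 : y < 1)
    (hy : boseFunction ((d : ℝ) / 2) y < ρ * Λ ^ d) :
    ∀ᶠ i in l, y < Z (L i) (M i) / Z (L i) (M i + 1) := by
  have h1 := tendsto_grandCanonical_density (d := d) hΛ hL hy0 hy1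
  have h2 := tendsto_add_const_density hd hL hM 1
  have h3 : boseFunction ((d : ℝ) / 2) y / Λ ^ d < ρ := (div_lt_iff₀ (by positivity)).2 hy
  filter_upwards [h1.eventually_lt h2 h3, hL.eventually_gt_atTop 0] with i hi hLi
  by_contra! hle
  refine hi.not_ge ?_
  have hB := hZ _ hLi
  have hq : ∀ n, 0 ≤ boxTrace d Λ (L i) (n + 1) := fun n =>
    zero_le_one.trans (one_le_boxTrace hΛ hLi (Nat.succ_pos n))
  have hsum : Summable fun n : ℕ => boxTrace d Λ (L i) (n + 1) / L i ^ d * y ^ (n + 1) := by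
    refine Summable.of_nonneg_of_le (fun n => ?_) (fun n => ?_)
      (((summable_nat_add_iff 1).2 (summable_geometric_of_lt_one hy0 hy1)).mul_left
        (boxTrace d Λ (L i) 1 / L i ^ d))
    · have := hq n
      positivity
    · exact mul_le_mul_of_nonneg_right (div_le_div_of_nonneg_right
        (boxTrace_le_one_trace hΛ hLi (Nat.succ_pos n)) (by positivity)) (by positivity)
  refine le_trans ?_ (hsum.sum_le_tsum (Finset.range (M i + 1)) fun n _ => by
    have := hq n
    positivity)
  have h4 : ((M i : ℝ) + 1) * Z (L i) (M i + 1) ≤ (∑ n ∈ Finset.range (M i + 1),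
      boxTrace d Λ (L i) (n + 1) * y ^ (n + 1)) * Z (L i) (M i + 1) := by
    rw [hB.recursion, Finset.sum_mul]
    refine Finset.sum_le_sum fun n hn => ?_
    rw [Finset.mem_range] at hn
    rw [mul_assoc]
    refine mul_le_mul_of_nonneg_left ?_ (hq n)
    have h5 := hB.le_ratio_pow_mul (M := M i) (n + 1) (m := M i - n) (by omega)
    rw [show M i - n + (n + 1) = M i + 1 by omega] at h5
    exact h5.trans (mul_le_mul_of_nonneg_right
      (pow_le_pow_left₀ (hB.ratio_nonneg _) hle _) (hB.pos _).le)
  have h5 := le_of_mul_le_mul_right h4 (hB.pos _)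
  calc ((M i : ℝ) + 1) / L i ^ d
      ≤ (∑ n ∈ Finset.range (M i + 1), boxTrace d Λ (L i) (n + 1) * y ^ (n + 1)) / L i ^ d :=
        div_le_div_of_nonneg_right h5 (by positivity)
    _ = _ := by
      rw [Finset.sum_div]
      exact Finset.sum_congr rfl fun n _ => by ring

/-- The converse bound: adding `K` particles does not change the density, and by log-concavity the
recursion for `M + K` particles bounds the truncated grand canonical density at fugacity
`Z_M / Z_{M+1}`. -/
theorem eventually_ratio_lt (hd : d ≠ 0) (hΛ : 0 < Λ)
    (hZ : ∀ L, 0 < L → IsBoseSequence (boxTrace d Λ L) (Z L)) (hL : Tendsto L l atTop)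
    (hM : Tendsto (fun i => (M i : ℝ) / L i ^ d) l (𝓝 ρ)) (hy0 : 0 ≤ y) {K : ℕ}
    (hy : ρ * Λ ^ d < ∑ n ∈ Finset.range K, y ^ (n + 1) / ((n + 1 : ℕ) : ℝ) ^ ((d : ℝ) / 2)) :
    ∀ᶠ i in l, Z (L i) (M i) / Z (L i) (M i + 1) < y := by
  have h1 : Tendsto (fun i => ∑ n ∈ Finset.range K,
      boxTrace d Λ (L i) (n + 1) / L i ^ d * y ^ (n + 1)) l (𝓝 (∑ n ∈ Finset.range K,
      1 / (Λ ^ d * ((n + 1 : ℕ) : ℝ) ^ ((d : ℝ) / 2)) * y ^ (n + 1))) :=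
    tendsto_finsetSum _ fun n _ => (tendsto_boxTrace_div hΛ (Nat.succ_pos n) hL).mul_const _
  have h2 := tendsto_add_const_density hd hL hM K
  have h3 : ρ < ∑ n ∈ Finset.range K,
      1 / (Λ ^ d * ((n + 1 : ℕ) : ℝ) ^ ((d : ℝ) / 2)) * y ^ (n + 1) := by
    rw [← lt_div_iff₀ (by positivity), Finset.sum_div] at hy
    refine hy.trans_eq (Finset.sum_congr rfl fun n _ => by field_simp)
  filter_upwards [h2.eventually_lt h1 h3, hL.eventually_gt_atTop 0] with i hi hLi
  by_contra! hle
  refine hi.not_ge ?_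
  have hB := hZ _ hLi
  have hq : ∀ n, 0 ≤ boxTrace d Λ (L i) (n + 1) := fun n =>
    zero_le_one.trans (one_le_boxTrace hΛ hLi (Nat.succ_pos n))
  cases K with
  | zero =>
    simp only [Finset.range_zero, Finset.sum_empty]
    positivity
  | succ K =>
    have h4 : (∑ n ∈ Finset.range (K + 1), boxTrace d Λ (L i) (n + 1) * y ^ (n + 1)) *
        Z (L i) (M i + K + 1) ≤ (((M i + K : ℕ) : ℝ) + 1) * Z (L i) (M i + K + 1) := by
      rw [hB.recursion, Finset.sum_mul]
      refine le_trans (Finset.sum_le_sum fun n hn => ?_)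
        (Finset.sum_le_sum_of_subset_of_nonneg
          (Finset.range_mono (by omega : K + 1 ≤ M i + K + 1))
          fun n _ _ => mul_nonneg (hq n) (hB.pos _).le)
      rw [Finset.mem_range] at hn
      rw [mul_assoc]
      refine mul_le_mul_of_nonneg_left ?_ (hq n)
      have h5 := hB.ratio_pow_mul_le (M := M i) (n + 1) (m := M i + K - n) (by omega)
      rw [show M i + K - n + (n + 1) = M i + K + 1 by omega] at h5
      exact (mul_le_mul_of_nonneg_right (pow_le_pow_left₀ hy0 hle _) (hB.pos _).le).trans h5
    have h5 := le_of_mul_le_mul_right h4 (hB.pos _)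
    calc _ = (∑ n ∈ Finset.range (K + 1),
          boxTrace d Λ (L i) (n + 1) * y ^ (n + 1)) / L i ^ d := by
            rw [Finset.sum_div]
            exact Finset.sum_congr rfl fun n _ => by ring
      _ ≤ (((M i + K : ℕ) : ℝ) + 1) / L i ^ d := div_le_div_of_nonneg_right h5 (by positivity)
      _ = _ := by push_cast; ring

/-- `x` is the fugacity `e^{βμ}` of the infinite ideal gas whose density `ρ` satisfies
`c = ρ λ_β^d`: it solves `g_{d/2}(x) = c`, or it equals `1` and `g_{d/2}(1) ≤ c`. -/
structure IsFugacity (d : ℕ) (c x : ℝ) : Prop where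
  pos : 0 < x
  le_one : x ≤ 1
  bose_le : boseFunction ((d : ℝ) / 2) x ≤ c
  bose_eq : x < 1 → boseFunction ((d : ℝ) / 2) x = c

/-- The canonical fugacity `Z_M / Z_{M+1}` converges to the fugacity of the infinite gas. -/
theorem tendsto_ratio (hd : 3 ≤ d) (hΛ : 0 < Λ)
    (hZ : ∀ L, 0 < L → IsBoseSequence (boxTrace d Λ L) (Z L)) [l.NeBot] (hL : Tendsto L l atTop)
    (hM : Tendsto (fun i => (M i : ℝ) / L i ^ d) l (𝓝 ρ)) (hx : IsFugacity d (ρ * Λ ^ d) x) :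
    Tendsto (fun i => Z (L i) (M i) / Z (L i) (M i + 1)) l (𝓝 x) := by
  have hd0 : d ≠ 0 := by omega
  have hs : 1 < (d : ℝ) / 2 := by
    have : (3 : ℝ) ≤ d := by exact_mod_cast hd
    linarith
  rw [tendsto_order]
  constructor
  · intro b hb
    have hy : max b 0 < x := max_lt hb hx.pos
    have h := eventually_lt_ratio hd0 hΛ hZ hL hM (le_max_right b 0) (hy.trans_le hx.le_one)
      ((boseFunction_strictMonoOn hs ⟨le_max_right b 0, (hy.trans_le hx.le_one).le⟩
        ⟨hx.pos.le, hx.le_one⟩ hy).trans_le hx.bose_le)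
    exact h.mono fun i hi => (le_max_left b 0).trans_lt hi
  · intro b hb
    rcases hx.le_one.lt_or_eq with h1 | h1
    · have hy : x < min b 1 := lt_min hb h1
      have hy0 : 0 ≤ min b 1 := hx.pos.le.trans hy.le
      have h2 := boseFunction_strictMonoOn hs ⟨hx.pos.le, hx.le_one⟩ ⟨hy0, min_le_right b 1⟩ hy
      rw [hx.bose_eq h1] at h2
      obtain ⟨K, hK⟩ := exists_partial_sum_gt hs hy0 (min_le_right b 1) h2
      exact (eventually_ratio_lt hd0 hΛ hZ hL hM hy0 hK).mono
        fun i hi => hi.trans_le (min_le_left b 1)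
    · filter_upwards [hL.eventually_gt_atTop 0] with i hi
      exact ((hZ _ hi).ratio_le_one _).trans_lt (h1 ▸ hb)

/-- Removing a fixed number `n` of particles multiplies the partition function by `x ^ n`. -/
theorem tendsto_ratio_pow (hd : 3 ≤ d) (hΛ : 0 < Λ)
    (hZ : ∀ L, 0 < L → IsBoseSequence (boxTrace d Λ L) (Z L)) {L : ℕ → ℝ}
    (hL : Tendsto L atTop atTop) (hM : Tendsto (fun N : ℕ => (N : ℝ) / L N ^ d) atTop (𝓝 ρ))
    (hx : IsFugacity d (ρ * Λ ^ d) x) (n : ℕ) :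
    Tendsto (fun N : ℕ => Z (L N) (N + 1 - n) / Z (L N) (N + 1)) atTop (𝓝 (x ^ n)) := by
  induction n with
  | zero =>
    refine tendsto_const_nhds.congr' ?_
    filter_upwards [hL.eventually_gt_atTop 0] with N hN
    simp [((hZ _ hN).pos (N + 1)).ne']
  | succ n ih =>
    have hM' : Tendsto (fun N : ℕ => ((N - n : ℕ) : ℝ) / L N ^ d) atTop (𝓝 ρ) := by
      refine (tendsto_add_const_density (by omega) hL hM (-(n : ℝ))).congr' ?_
      filter_upwards [eventually_ge_atTop n] with N hN
      rw [Nat.cast_sub hN]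
      ring
    have h := (tendsto_ratio hd hΛ hZ hL hM' hx).mul ih
    rw [pow_succ']
    refine h.congr' ?_
    filter_upwards [hL.eventually_gt_atTop 0, eventually_ge_atTop n] with N hN hn
    rw [show N + 1 - (n + 1) = N - n by omega, show N - n + 1 = N + 1 - n by omega]
    have := (hZ _ hN).pos (N + 1 - n)
    field_simp

end Ratio

/-! ### Sums over cycle lengths -/

/-- Dominated convergence for sums of growing length, where the dominating sequence may be exceeded
by an error of vanishing total size. -/
theorem tendsto_sum_range_of_dominated_add {b e : ℕ → ℕ → ℝ} {B t : ℕ → ℝ} (hB : Summable B)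
    (hb0 : ∀ N n, n ≤ N → 0 ≤ b N n) (he0 : ∀ N n, 0 ≤ e N n)
    (hbB : ∀ N n, n ≤ N → b N n ≤ B n + e N n)
    (hlim : ∀ n, Tendsto (fun N => b N n) atTop (𝓝 (t n)))
    (he : Tendsto (fun N => ∑ n ∈ Finset.range (N + 1), e N n) atTop (𝓝 0)) :
    Summable t ∧
      Tendsto (fun N => ∑ n ∈ Finset.range (N + 1), b N n) atTop (𝓝 (∑' n, t n)) := by
  have he1 : ∀ n, Tendsto (fun N => e N n) atTop (𝓝 0) := fun n =>
    squeeze_zero' (Eventually.of_forall fun N => he0 N n)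
      ((eventually_ge_atTop n).mono fun N hN => Finset.single_le_sum (f := fun k => e N k)
        (fun k _ => he0 N k) (Finset.mem_range.2 (Nat.lt_succ_of_le hN))) he
  have ht0 : ∀ n, 0 ≤ t n := fun n =>
    ge_of_tendsto (hlim n) ((eventually_ge_atTop n).mono fun N hN => hb0 N n hN)
  have htB : ∀ n, t n ≤ B n := fun n => by
    have h := (he1 n).const_add (B n)
    rw [add_zero] at h
    exact le_of_tendsto_of_tendsto (hlim n) h
      ((eventually_ge_atTop n).mono fun N hN => hbB N n hN)
  have hB0 : ∀ n, 0 ≤ B n := fun n => (ht0 n).trans (htB n)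
  refine ⟨Summable.of_nonneg_of_le ht0 htB hB, ?_⟩
  -- the truncated terms `min b B` are dominated by `B`
  have h1 : Tendsto (fun N => ∑' n, if n ≤ N then min (b N n) (B n) else 0) atTop
      (𝓝 (∑' n, t n)) := by
    refine tendsto_tsum_of_dominated_convergence hB (fun n => ?_) ?_
    · have h := (hlim n).min (tendsto_const_nhds (x := B n))
      rw [min_eq_left (htB n)] at h
      refine h.congr' ((eventually_ge_atTop n).mono fun N hN => ?_)
      exact (if_pos hN).symm
    · refine Eventually.of_forall fun N n => ?_
      split_ifs with h
      · rw [Real.norm_of_nonneg (le_min (hb0 N n h) (hB0 n))]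
        exact min_le_right _ _
      · simpa using hB0 n
  have h2 : ∀ N, ∑' n, (if n ≤ N then min (b N n) (B n) else 0) =
      ∑ n ∈ Finset.range (N + 1), min (b N n) (B n) := by
    intro N
    rw [tsum_eq_sum (s := Finset.range (N + 1))]
    · exact Finset.sum_congr rfl fun n hn =>
        if_pos (Nat.lt_succ_iff.1 (Finset.mem_range.1 hn))
    · intro n hn
      exact if_neg fun h => hn (Finset.mem_range.2 (Nat.lt_succ_of_le h))
  simp only [h2] at h1
  have h3 := h1.add he
  rw [add_zero] at h3
  refine tendsto_of_tendsto_of_tendsto_of_le_of_le h1 h3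
    (fun N => Finset.sum_le_sum fun n _ => min_le_left _ _) fun N => ?_
  simp only [← Finset.sum_add_distrib]
  refine Finset.sum_le_sum fun n hn => ?_
  rw [← min_add_add_right]
  exact le_min (le_add_of_nonneg_right (he0 N n))
    (hbB N n (Nat.lt_succ_iff.1 (Finset.mem_range.1 hn)))

theorem sum_inv_sqrt_le (N : ℕ) :
    ∑ n ∈ Finset.range N, 1 / Real.sqrt ((n + 1 : ℕ) : ℝ) ≤ 2 * Real.sqrt N := by
  induction N with
  | zero => simp
  | succ N ih =>
    rw [Finset.sum_range_succ]
    have h0 : (0 : ℝ) ≤ N := Nat.cast_nonneg N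
    have h1 : 0 < Real.sqrt ((N + 1 : ℕ) : ℝ) := Real.sqrt_pos.2 (by positivity)
    have h2 := Real.sq_sqrt h0
    have h3 := Real.sq_sqrt (show (0 : ℝ) ≤ ((N + 1 : ℕ) : ℝ) by positivity)
    have h4 : 1 / Real.sqrt ((N + 1 : ℕ) : ℝ) ≤
        2 * Real.sqrt ((N + 1 : ℕ) : ℝ) - 2 * Real.sqrt N := by
      rw [div_le_iff₀ h1]
      push_cast at *
      nlinarith [sq_nonneg (Real.sqrt ((N : ℝ) + 1) - Real.sqrt N)]
    linarith

/-- The number of integers in `(a, b]` exceeds `b - a` by at most one. -/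
theorem card_filter_between_le {a b : ℝ} (ha : 0 ≤ a) (hab : a ≤ b) (N : ℕ) :
    (((Finset.range N).filter fun n => a < ((n + 1 : ℕ) : ℝ) ∧ ((n + 1 : ℕ) : ℝ) ≤ b).card : ℝ) ≤
      b - a + 1 := by
  have hb := ha.trans hab
  have h1 : ((Finset.range N).filter fun n =>
      a < ((n + 1 : ℕ) : ℝ) ∧ ((n + 1 : ℕ) : ℝ) ≤ b).card ≤ (Finset.Ioc ⌊a⌋₊ ⌊b⌋₊).card := by
    refine Finset.card_le_card_of_injOn (fun n => n + 1) (fun n hn => ?_)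
      fun m _ n _ h => Nat.succ_injective h
    obtain ⟨-, h1, h2⟩ := Finset.mem_filter.1 hn
    exact Finset.mem_coe.2 (Finset.mem_Ioc.2 ⟨(Nat.floor_lt ha).2 h1, (Nat.le_floor_iff hb).2 h2⟩)
  rw [Nat.card_Ioc] at h1
  have h2 : (⌊a⌋₊ : ℝ) ≤ ⌊b⌋₊ := Nat.cast_le.2 (Nat.floor_le_floor hab)
  have h3 := Nat.floor_le hb
  have h4 := Nat.lt_floor_add_one a
  have h5 : (((⌊b⌋₊ - ⌊a⌋₊ : ℕ)) : ℝ) = (⌊b⌋₊ : ℝ) - ⌊a⌋₊ :=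
    Nat.cast_sub (Nat.floor_le_floor hab)
  have h6 : (((Finset.range N).filter fun n =>
      a < ((n + 1 : ℕ) : ℝ) ∧ ((n + 1 : ℕ) : ℝ) ≤ b).card : ℝ) ≤ ((⌊b⌋₊ - ⌊a⌋₊ : ℕ) : ℝ) :=
    Nat.cast_le.2 h1
  linarith

/-- If the weights `r N n ∈ [0, 1]` have mean tending to `t₀`, and if their part beyond `t N` is
negligible for every `t > t₀`, then they fill `[0, t₀ N]` completely, so that the part beyond `ε N`
tends to `max (t₀ - ε) 0`. -/
theorem tendsto_tail_of_saturated {r : ℕ → ℕ → ℝ} {t₀ ε : ℝ} (hr0 : ∀ N n, 0 ≤ r N n)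
    (hr1 : ∀ N n, r N n ≤ 1) (ht1 : t₀ < 1)
    (hmean : Tendsto (fun N : ℕ => ∑ n ∈ Finset.range (N + 1), r N n / ((N : ℝ) + 1)) atTop
      (𝓝 t₀))
    (htail : ∀ t, t₀ < t → t < 1 → Tendsto (fun N : ℕ => ∑ n ∈ Finset.range (N + 1),
      if t * ((N : ℝ) + 1) < ((n + 1 : ℕ) : ℝ) then r N n / ((N : ℝ) + 1) else 0) atTop (𝓝 0))
    (hε : 0 < ε) :
    Tendsto (fun N : ℕ => ∑ n ∈ Finset.range (N + 1),
      if ε * ((N : ℝ) + 1) < ((n + 1 : ℕ) : ℝ) then r N n / ((N : ℝ) + 1) else 0) atTop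
      (𝓝 (max (t₀ - ε) 0)) := by
  have hinv : Tendsto (fun N : ℕ => 1 / ((N : ℝ) + 1)) atTop (𝓝 0) :=
    tendsto_one_div_add_atTop_nhds_zero_nat
  have hnn : ∀ N n, 0 ≤ r N n / ((N : ℝ) + 1) := fun N n =>
    div_nonneg (hr0 N n) (by positivity)
  -- a window of relative length `t - s` carries at most this weight
  have hwin : ∀ s t : ℝ, 0 ≤ s → s ≤ t → ∀ N : ℕ, (∑ n ∈ Finset.range (N + 1),
      if s * ((N : ℝ) + 1) < ((n + 1 : ℕ) : ℝ) then r N n / ((N : ℝ) + 1) else 0) ≤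
      (t - s + 1 / ((N : ℝ) + 1)) + ∑ n ∈ Finset.range (N + 1),
      if t * ((N : ℝ) + 1) < ((n + 1 : ℕ) : ℝ) then r N n / ((N : ℝ) + 1) else 0 := by
    intro s t hs hst N
    have hN : (0 : ℝ) < (N : ℝ) + 1 := by positivity
    have h1 := card_filter_between_le (mul_nonneg hs hN.le)
      (mul_le_mul_of_nonneg_right hst hN.le) (N + 1)
    have h2 : (∑ n ∈ Finset.range (N + 1),
        if s * ((N : ℝ) + 1) < ((n + 1 : ℕ) : ℝ) ∧ ((n + 1 : ℕ) : ℝ) ≤ t * ((N : ℝ) + 1) then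
          1 / ((N : ℝ) + 1) else 0) ≤ t - s + 1 / ((N : ℝ) + 1) := by
      rw [← Finset.sum_filter, Finset.sum_const, nsmul_eq_mul, mul_one_div, div_le_iff₀ hN]
      refine h1.trans (le_of_eq ?_)
      field_simp
    refine le_trans ?_ (add_le_add_left h2 _)
    rw [← Finset.sum_add_distrib]
    refine Finset.sum_le_sum fun n _ => ?_
    have h3 : r N n / ((N : ℝ) + 1) ≤ 1 / ((N : ℝ) + 1) :=
      div_le_div_of_nonneg_right (hr1 N n) hN.le
    have h4 := hnn N n
    have h5 : 0 ≤ 1 / ((N : ℝ) + 1) := by positivity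
    by_cases hA : t * ((N : ℝ) + 1) < ((n + 1 : ℕ) : ℝ)
    · rw [if_pos (lt_of_le_of_lt (mul_le_mul_of_nonneg_right hst hN.le) hA), if_pos hA,
        if_neg (fun h => h.2.not_gt hA), zero_add]
    · by_cases hC : s * ((N : ℝ) + 1) < ((n + 1 : ℕ) : ℝ)
      · rw [if_pos hC, if_pos ⟨hC, not_lt.1 hA⟩, if_neg hA, add_zero]
        exact h3
      · rw [if_neg hC, if_neg (fun h => hC h.1), if_neg hA, add_zero]
  have hzero : ∀ N : ℕ, (∑ n ∈ Finset.range (N + 1),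
      if (0 : ℝ) * ((N : ℝ) + 1) < ((n + 1 : ℕ) : ℝ) then r N n / ((N : ℝ) + 1) else 0) =
      ∑ n ∈ Finset.range (N + 1), r N n / ((N : ℝ) + 1) := fun N =>
    Finset.sum_congr rfl fun n _ => if_pos (by rw [zero_mul]; positivity)
  rw [tendsto_order]
  constructor
  · intro a ha
    rcases lt_max_iff.1 ha with ha | ha
    · have h1 : Tendsto (fun N : ℕ => (∑ n ∈ Finset.range (N + 1), r N n / ((N : ℝ) + 1)) -
          (ε - 0 + 1 / ((N : ℝ) + 1))) atTop (𝓝 (t₀ - (ε - 0 + 0))) :=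
        hmean.sub (hinv.const_add _)
      filter_upwards [h1.eventually_const_lt (by linarith : a < t₀ - (ε - 0 + 0))] with N hN
      have h2 := hwin 0 ε le_rfl hε.le N
      rw [hzero] at h2
      linarith
    · refine Eventually.of_forall fun N => ha.trans_le (Finset.sum_nonneg fun n _ => ?_)
      split_ifs
      · exact hnn N n
      · exact le_rfl
  · intro b hb
    obtain ⟨h1, h2⟩ := max_lt_iff.1 hb
    rcases lt_or_ge t₀ ε with hlt | hge
    · -- any `t` in `(t₀, min ε 1)` bounds the tail beyond `ε`
      obtain ⟨t, ht, ht'⟩ := exists_between (lt_min hlt ht1)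
      filter_upwards [(htail t ht (ht'.trans_le (min_le_right _ _))).eventually_lt_const h2]
        with N hN
      refine lt_of_le_of_lt (Finset.sum_le_sum fun n _ => ?_) hN
      have h3 : t * ((N : ℝ) + 1) ≤ ε * ((N : ℝ) + 1) :=
        mul_le_mul_of_nonneg_right (ht'.trans_le (min_le_left _ _)).le (by positivity)
      by_cases hA : ε * ((N : ℝ) + 1) < ((n + 1 : ℕ) : ℝ)
      · rw [if_pos hA, if_pos (h3.trans_lt hA)]
      · rw [if_neg hA]
        split_ifs
        · exact hnn N n
        · exact le_rfl
    · obtain ⟨t, ht, ht'⟩ := exists_between (lt_min ht1 (by linarith : t₀ < b + ε))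
      have h3 : Tendsto (fun N : ℕ => (t - ε + 1 / ((N : ℝ) + 1)) +
          ∑ n ∈ Finset.range (N + 1),
          if t * ((N : ℝ) + 1) < ((n + 1 : ℕ) : ℝ) then r N n / ((N : ℝ) + 1) else 0) atTop
          (𝓝 ((t - ε + 0) + 0)) :=
        (hinv.const_add _).add (htail t ht (ht'.trans_le (min_le_left _ _)))
      have h4 : t < b + ε := ht'.trans_le (min_le_right _ _)
      filter_upwards [h3.eventually_lt_const (by linarith : t - ε + 0 + 0 < b)] with N hN
      exact (hwin ε t hε.le (hge.trans ht.le) N).trans_lt hN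

section Thermodynamic

variable {d : ℕ} {Λ ρ x : ℝ} {Z : ℝ → ℕ → ℝ} {L : ℕ → ℝ}

/-- The limit law `x ^ n / (ρ λ^d n^{d/2})` of the length of the cycle of the first particle,
with the index shifted by one. -/
def cycleLaw (d : ℕ) (Λ ρ x : ℝ) (n : ℕ) : ℝ :=
  x ^ (n + 1) / (ρ * Λ ^ d * ((n + 1 : ℕ) : ℝ) ^ ((d : ℝ) / 2))

theorem tsum_cycleLaw : ∑' n, cycleLaw d Λ ρ x n =
    boseFunction ((d : ℝ) / 2) x / (ρ * Λ ^ d) := by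
  rw [boseFunction, ← tsum_div_const]
  exact tsum_congr fun n => by rw [cycleLaw, div_div, mul_comm]

theorem tendsto_density (hρ : 0 < ρ)
    (hLd : ∀ N, L N ^ d = ((N : ℝ) + 1) / ρ) :
    Tendsto (fun N : ℕ => (N : ℝ) / L N ^ d) atTop (𝓝 ρ) := by
  have h := (tendsto_natCast_div_add_atTop (1 : ℝ)).const_mul ρ
  rw [mul_one] at h
  refine h.congr fun N => ?_
  rw [hLd]
  field_simp

theorem tendsto_cycle_term (hd : 3 ≤ d) (hΛ : 0 < Λ) (hρ : 0 < ρ)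
    (hZ : ∀ L, 0 < L → IsBoseSequence (boxTrace d Λ L) (Z L)) (hLpos : ∀ N, 0 < L N)
    (hLd : ∀ N, L N ^ d = ((N : ℝ) + 1) / ρ) (hL : Tendsto L atTop atTop)
    (hx : IsFugacity d (ρ * Λ ^ d) x) (n : ℕ) :
    Tendsto (fun N : ℕ => boxTrace d Λ (L N) (n + 1) *
      (Z (L N) (N - n) / (((N : ℝ) + 1) * Z (L N) (N + 1)))) atTop (𝓝 (cycleLaw d Λ ρ x n)) := by
  have h1 := tendsto_ratio_pow hd hΛ hZ hL (tendsto_density hρ hLd) hx (n + 1)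
  have h2 := ((tendsto_boxTrace_div (d := d) hΛ (Nat.succ_pos n) hL).div_const ρ).mul h1
  have h3 : 1 / (Λ ^ d * ((n.succ : ℕ) : ℝ) ^ ((d : ℝ) / 2)) / ρ * x ^ (n + 1) =
      cycleLaw d Λ ρ x n := by
    rw [cycleLaw]
    field_simp
  rw [h3] at h2
  refine h2.congr fun N => ?_
  rw [hLd, Nat.add_sub_add_right]
  have := (hZ _ (hLpos N)).pos (N + 1)
  field_simp

/-- The finite-size excess of the traces `q_n` over the contribution `1` of the ground state is
dominated by `C / n^{d/2}` up to an error that vanishes because `L / √N → 0` for `d ≥ 3`. -/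
theorem tendsto_sum_excited (hd : 3 ≤ d) (hΛ : 0 < Λ) (hρ : 0 < ρ)
    (hLpos : ∀ N, 0 < L N)
    (hLd : ∀ N, L N ^ d = ((N : ℝ) + 1) / ρ) (hL : Tendsto L atTop atTop)
    {r : ℕ → ℕ → ℝ} {t : ℕ → ℝ} (hr0 : ∀ N n, 0 ≤ r N n) (hr1 : ∀ N n, r N n ≤ 1)
    (hlim : ∀ n, Tendsto (fun N : ℕ =>
      (boxTrace d Λ (L N) (n + 1) - 1) * (r N n / ((N : ℝ) + 1))) atTop (𝓝 (t n))) :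
    Summable t ∧ Tendsto (fun N : ℕ => ∑ n ∈ Finset.range (N + 1),
      (boxTrace d Λ (L N) (n + 1) - 1) * (r N n / ((N : ℝ) + 1))) atTop (𝓝 (∑' n, t n)) := by
  have hs : 1 < (d : ℝ) / 2 := by
    have : (3 : ℝ) ≤ d := by exact_mod_cast hd
    linarith
  have hq : ∀ N n, 0 ≤ boxTrace d Λ (L N) (n + 1) - 1 := fun N n =>
    sub_nonneg.2 (one_le_boxTrace hΛ (hLpos N) (Nat.succ_pos n))
  refine tendsto_sum_range_of_dominated_add
    (B := fun n => 3 ^ d / (ρ * Λ ^ d) * (1 / ((n + 1 : ℕ) : ℝ) ^ ((d : ℝ) / 2)))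
    (e := fun N n => 3 ^ d * (L N / Λ) / ((N : ℝ) + 1) * (1 / Real.sqrt ((n + 1 : ℕ) : ℝ)))
    ((summable_inv_rpow hs).mul_left _) (fun N n _ => ?_) (fun N n => ?_) (fun N n _ => ?_) hlim ?_
  · exact mul_nonneg (hq N n) (div_nonneg (hr0 N n) (by positivity))
  · have := hLpos N
    positivity
  · have hN : (0 : ℝ) < (N : ℝ) + 1 := by positivity
    have h1 := boxTrace_le (d := d) hΛ (hLpos N) (Nat.succ_pos n)
    rw [hLd] at h1
    calc (boxTrace d Λ (L N) (n + 1) - 1) * (r N n / ((N : ℝ) + 1))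
        ≤ (boxTrace d Λ (L N) (n + 1) - 1) * (1 / ((N : ℝ) + 1)) :=
          mul_le_mul_of_nonneg_left (div_le_div_of_nonneg_right (hr1 N n) hN.le) (hq N n)
      _ ≤ (3 ^ d * (L N / Λ / Real.sqrt (n.succ : ℕ) +
          ((N : ℝ) + 1) / ρ / (Λ ^ d * ((n.succ : ℕ) : ℝ) ^ ((d : ℝ) / 2)))) *
            (1 / ((N : ℝ) + 1)) :=
          mul_le_mul_of_nonneg_right (by linarith) (by positivity)
      _ = _ := by
        have : 0 < Real.sqrt ((n + 1 : ℕ) : ℝ) := Real.sqrt_pos.2 (by positivity)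
        have : 0 < ((n + 1 : ℕ) : ℝ) ^ ((d : ℝ) / 2) := by positivity
        simp only [Nat.succ_eq_add_one]
        field_simp
        ring
  · have h1 : Tendsto (fun N : ℕ => 2 * 3 ^ d / Λ * Real.sqrt (1 / ρ / L N ^ (d - 2))) atTop
        (𝓝 (2 * 3 ^ d / Λ * Real.sqrt 0)) :=
      ((Real.continuous_sqrt.tendsto 0).comp (Tendsto.const_div_atTop
        ((tendsto_pow_atTop (by omega : d - 2 ≠ 0)).comp hL) (1 / ρ))).const_mul _
    rw [Real.sqrt_zero, mul_zero] at h1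
    refine squeeze_zero (fun N => Finset.sum_nonneg fun n _ => ?_) (fun N => ?_) h1
    · have := hLpos N
      positivity
    · have hN : (0 : ℝ) < (N : ℝ) + 1 := by positivity
      have hLN := hLpos N
      have h2 : 1 / ρ / L N ^ (d - 2) = (L N / Real.sqrt ((N : ℝ) + 1)) ^ 2 := by
        have h3 : L N ^ (d - 2) * L N ^ 2 = ((N : ℝ) + 1) / ρ := by
          rw [← pow_add, ← hLd, Nat.sub_add_cancel (by omega)]
        rw [div_pow, Real.sq_sqrt hN.le, div_eq_div_iff (by positivity) hN.ne', mul_comm (L N ^ 2),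
          h3]
        ring
      rw [h2, Real.sqrt_sq (by positivity), ← Finset.mul_sum]
      have h4 := sum_inv_sqrt_le (N + 1)
      have h5 : 0 ≤ 3 ^ d * (L N / Λ) / ((N : ℝ) + 1) := by positivity
      refine (mul_le_mul_of_nonneg_left h4 h5).trans (le_of_eq ?_)
      have h6 : 0 < Real.sqrt ((N : ℝ) + 1) := Real.sqrt_pos.2 hN
      have h7 := Real.sq_sqrt hN.le
      push_cast
      rw [div_mul_eq_mul_div, div_eq_iff hN.ne']
      field_simp
      rw [h7]

/-- Beyond the relative size `t` of the condensate the remaining gas has a density below the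
critical one, so that its partition functions grow geometrically. -/
theorem tendsto_tail_zero (hd : 3 ≤ d) (hΛ : 0 < Λ) (hρ : 0 < ρ)
    (hZ : ∀ L, 0 < L → IsBoseSequence (boxTrace d Λ L) (Z L)) (hLpos : ∀ N, 0 < L N)
    (hLd : ∀ N, L N ^ d = ((N : ℝ) + 1) / ρ) (hL : Tendsto L atTop atTop) {t : ℝ} (ht0 : 0 < t)
    (ht1 : t < 1) (ht : (1 - t) * ρ * Λ ^ d < boseFunction ((d : ℝ) / 2) 1) :
    Tendsto (fun N : ℕ => ∑ n ∈ Finset.range (N + 1),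
      if t * ((N : ℝ) + 1) < ((n + 1 : ℕ) : ℝ) then
        Z (L N) (N - n) / Z (L N) (N + 1) / ((N : ℝ) + 1) else 0) atTop (𝓝 0) := by
  have hs : 1 < (d : ℝ) / 2 := by
    have : (3 : ℝ) ≤ d := by exact_mod_cast hd
    linarith
  obtain ⟨K, hK⟩ := exists_partial_sum_gt hs zero_le_one le_rfl ht
  -- a truncated sum that is large at `1` is large at some `y < 1`
  obtain ⟨y, hy0, hy1, hy⟩ : ∃ y : ℝ, 0 ≤ y ∧ y < 1 ∧ (1 - t) * ρ * Λ ^ d <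
      ∑ n ∈ Finset.range K, y ^ (n + 1) / ((n + 1 : ℕ) : ℝ) ^ ((d : ℝ) / 2) := by
    have hc : Continuous fun y : ℝ =>
        ∑ n ∈ Finset.range K, y ^ (n + 1) / ((n + 1 : ℕ) : ℝ) ^ ((d : ℝ) / 2) := by fun_prop
    have h1 := ((hc.tendsto 1).mono_left
      (nhdsWithin_le_nhds (s := Set.Iio 1))).eventually_const_lt hK
    have h2 : ∀ᶠ y : ℝ in 𝓝[<] 1, 0 < y :=
      nhdsWithin_le_nhds (lt_mem_nhds one_pos)
    obtain ⟨y, h3, h4, h5⟩ := (h1.and (h2.and self_mem_nhdsWithin)).exists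
    exact ⟨y, h4.le, h5, h3⟩
  set M : ℕ → ℕ := fun N => ⌊(1 - t) * ((N : ℝ) + 1)⌋₊ with hM
  have hMd : Tendsto (fun N => (M N : ℝ) / L N ^ d) atTop (𝓝 ((1 - t) * ρ)) := by
    have h1 := ((tendsto_nat_floor_mul_div_atTop (sub_nonneg.2 ht1.le)).comp
      ((tendsto_atTop_add_const_right _ (1 : ℝ) tendsto_natCast_atTop_atTop))).mul_const ρ
    refine h1.congr fun N => ?_
    rw [hLd]
    simp only [Function.comp, hM]
    field_simp
  have hev := eventually_ratio_lt (by omega) hΛ hZ hL hMd hy0 hy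
  have hlim : Tendsto (fun N : ℕ => (1 - y)⁻¹ / ((N : ℝ) + 1)) atTop (𝓝 0) := by
    have := (tendsto_one_div_add_atTop_nhds_zero_nat (𝕜 := ℝ)).const_mul ((1 - y)⁻¹)
    rw [mul_zero] at this
    exact this.congr fun N => by ring
  refine squeeze_zero' (Eventually.of_forall fun N => Finset.sum_nonneg fun n _ => ?_) ?_ hlim
  · split_ifs
    · have h1 := ((hZ _ (hLpos N)).pos (N - n)).le
      have h2 := ((hZ _ (hLpos N)).pos (N + 1)).le
      positivity
    · exact le_rfl
  · filter_upwards [hev] with N hN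
    have hB := hZ _ (hLpos N)
    have hN1 : (0 : ℝ) < (N : ℝ) + 1 := by positivity
    have hMN : M N + 1 ≤ N + 1 := by
      have h1 : (1 - t) * ((N : ℝ) + 1) < ((N + 1 : ℕ) : ℝ) := by
        push_cast
        nlinarith
      have h2 : 0 ≤ (1 - t) * ((N : ℝ) + 1) := mul_nonneg (sub_nonneg.2 ht1.le) hN1.le
      exact (Nat.floor_lt h2).2 h1
    rw [← Finset.sum_filter]
    set s := (Finset.range (N + 1)).filter fun n => t * ((N : ℝ) + 1) < ((n + 1 : ℕ) : ℝ) with hs'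
    have hle : ∀ n ∈ s, n ≤ N ∧ N - n ≤ M N := by
      intro n hn
      obtain ⟨h1, h2⟩ := Finset.mem_filter.1 hn
      have h3 : n ≤ N := Nat.lt_succ_iff.1 (Finset.mem_range.1 h1)
      refine ⟨h3, Nat.le_floor ?_⟩
      rw [Nat.cast_sub h3]
      push_cast at h2
      linarith
    have hterm : ∀ n ∈ s, Z (L N) (N - n) / Z (L N) (N + 1) / ((N : ℝ) + 1) ≤
        y ^ (M N - (N - n)) / ((N : ℝ) + 1) := by
      intro n hn
      obtain ⟨h1, h2⟩ := hle n hn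
      refine div_le_div_of_nonneg_right ?_ hN1.le
      rw [div_le_iff₀ (hB.pos _)]
      have h3 := hB.le_ratio_pow_mul (M := M N) (M N + 1 - (N - n)) (m := N - n) (by omega)
      rw [show N - n + (M N + 1 - (N - n)) = M N + 1 by omega] at h3
      have h4 : (Z (L N) (M N) / Z (L N) (M N + 1)) ^ (M N + 1 - (N - n)) ≤
          y ^ (M N - (N - n)) :=
        (pow_le_pow_left₀ (hB.ratio_nonneg _) hN.le _).trans
          (pow_le_pow_of_le_one hy0 hy1.le (by omega))
      exact h3.trans (mul_le_mul h4 (hB.mono hMN) (hB.pos _).le (pow_nonneg hy0 _))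
    refine (Finset.sum_le_sum hterm).trans ?_
    rw [← Finset.sum_div]
    refine div_le_div_of_nonneg_right ?_ hN1.le
    have hinj : Set.InjOn (fun n => M N - (N - n)) s := by
      intro a ha b hb hab
      have h1 := hle a ha
      have h2 := hle b hb
      simp only at hab
      omega
    rw [← Finset.sum_image (f := fun j => y ^ j) hinj, ← tsum_geometric_of_lt_one hy0 hy1]
    exact (summable_geometric_of_lt_one hy0 hy1).sum_le_tsum _ fun j _ => pow_nonneg hy0 j

end Thermodynamic

/-! ### The chemical potential -/

section ChemicalPotential

variable {d : ℕ} {hbar m β ρ μ : ℝ}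

theorem criticalDensity_eq : criticalDensity d hbar m β =
    boseFunction ((d : ℝ) / 2) 1 / thermalLength hbar m β ^ d := by
  simp [criticalDensity, boseFunction]

theorem gaussian_term_eq (hhbar : 0 < hbar) (hm : 0 < m) (hβ : 0 < β) (n : ℕ) :
    (Real.pi / (((n + 1 : ℕ) : ℝ) * (β * hbar ^ 2 / (2 * m)))) ^ ((d : ℝ) / 2) =
      (2 * Real.pi) ^ d / thermalLength hbar m β ^ d *
        (1 / ((n + 1 : ℕ) : ℝ) ^ ((d : ℝ) / 2)) := by
  have hΛ := thermalLength_pos hhbar hm hβ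
  have hpi := Real.pi_pos
  have h1 : Real.pi / (((n + 1 : ℕ) : ℝ) * (β * hbar ^ 2 / (2 * m))) =
      (2 * Real.pi / thermalLength hbar m β) ^ 2 / ((n + 1 : ℕ) : ℝ) := by
    rw [div_pow, thermalLength_sq hhbar hm hβ]
    field_simp
  rw [h1, Real.div_rpow (by positivity) (by positivity), ← sqrt_pow_eq_rpow d (by positivity),
    Real.sqrt_sq (by positivity), div_pow, mul_one_div]

/-- The density of the ideal gas is a Bose function of the fugacity: the Bose distribution is
expanded in a geometric series of Gaussians. At `μ = 0` the expansion fails at `k = 0` only. -/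
theorem integral_bose (hd : 3 ≤ d) (hhbar : 0 < hbar) (hm : 0 < m) (hβ : 0 < β) (hμ : μ ≤ 0) :
    1 / (2 * Real.pi) ^ d * ∫ k : EuclideanSpace ℝ (Fin d),
        1 / (Real.exp (β * (hbar ^ 2 * ‖k‖ ^ 2 / (2 * m) - μ)) - 1) =
      boseFunction ((d : ℝ) / 2) (Real.exp (β * μ)) / thermalLength hbar m β ^ d := by
  have hs : 1 < (d : ℝ) / 2 := by
    have : (3 : ℝ) ≤ d := by exact_mod_cast hd
    linarith
  have hΛ := thermalLength_pos hhbar hm hβ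
  have hpi := Real.pi_pos
  set x := Real.exp (β * μ) with hx
  have hx0 : 0 < x := Real.exp_pos _
  have hx1 : x ≤ 1 := Real.exp_le_one_iff.2 (mul_nonpos_of_nonneg_of_nonpos hβ.le hμ)
  set a := β * hbar ^ 2 / (2 * m) with ha
  have ha0 : 0 < a := by positivity
  have hna : ∀ n : ℕ, 0 < ((n + 1 : ℕ) : ℝ) * a := fun n => by positivity
  set F : ℕ → EuclideanSpace ℝ (Fin d) → ℝ :=
    fun n k => x ^ (n + 1) * Real.exp (-(((n + 1 : ℕ) : ℝ) * a) * ‖k‖ ^ 2) with hF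
  have hgauss : ∀ n, ∫ k : EuclideanSpace ℝ (Fin d),
      Real.exp (-(((n + 1 : ℕ) : ℝ) * a) * ‖k‖ ^ 2) =
      (2 * Real.pi) ^ d / thermalLength hbar m β ^ d *
        (1 / ((n + 1 : ℕ) : ℝ) ^ ((d : ℝ) / 2)) := fun n => by
    rw [GaussianFourier.integral_rexp_neg_mul_sq_norm (hna n), finrank_euclideanSpace_fin,
      gaussian_term_eq hhbar hm hβ]
  have hint : ∀ n, Integrable (F n) := fun n => by
    refine Integrable.const_mul ?_ _
    -- a function whose Bochner integral is not zero is integrable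
    refine not_imp_comm.1 integral_undef ?_
    rw [hgauss]
    positivity
  have hFint : ∀ n, ∫ k, F n k = (2 * Real.pi) ^ d / thermalLength hbar m β ^ d *
      (x ^ (n + 1) / ((n + 1 : ℕ) : ℝ) ^ ((d : ℝ) / 2)) := fun n => by
    simp only [hF]
    rw [integral_const_mul, hgauss]
    ring
  have hnorm : ∀ n, ∫ k, ‖F n k‖ = ∫ k, F n k := fun n =>
    integral_congr_ae (Eventually.of_forall fun k =>
      Real.norm_of_nonneg (mul_nonneg (pow_nonneg hx0.le _) (Real.exp_pos _).le))
  have hsum : Summable fun n => ∫ k, ‖F n k‖ := by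
    simp only [hnorm, hFint]
    exact (summable_bose hs hx0.le hx1).mul_left _
  have h1 := (hasSum_integral_of_summable_integral_norm hint hsum).tsum_eq
  have h2 : ∫ k : EuclideanSpace ℝ (Fin d),
      1 / (Real.exp (β * (hbar ^ 2 * ‖k‖ ^ 2 / (2 * m) - μ)) - 1) = ∫ k, ∑' n, F n k := by
    have : Nonempty (Fin d) := ⟨⟨0, by omega⟩⟩
    have hne : ∀ᵐ k : EuclideanSpace ℝ (Fin d), k ≠ 0 := by
      simp [ae_iff, measure_singleton]
    refine integral_congr_ae (hne.mono fun k hk => ?_)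
    have hk' : 0 < ‖k‖ := norm_pos_iff.2 hk
    -- the ratio of the geometric series
    set z := Real.exp (-(β * (hbar ^ 2 * ‖k‖ ^ 2 / (2 * m) - μ))) with hz
    have hpos : 0 < β * (hbar ^ 2 * ‖k‖ ^ 2 / (2 * m) - μ) := by
      have : 0 < hbar ^ 2 * ‖k‖ ^ 2 / (2 * m) := by positivity
      exact mul_pos hβ (by linarith)
    have hz0 : 0 < z := Real.exp_pos _
    have hz1 : z < 1 := Real.exp_lt_one_iff.2 (by linarith)
    have hFz : ∀ n, F n k = z * z ^ n := fun n => by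
      simp only [hF, hx, hz, ha]
      rw [← pow_succ', ← Real.exp_nat_mul, ← Real.exp_nat_mul, ← Real.exp_add]
      congr 1
      field_simp
      ring
    simp only [hFz]
    rw [tsum_mul_left, tsum_geometric_of_lt_one hz0.le hz1]
    have h3 : Real.exp (β * (hbar ^ 2 * ‖k‖ ^ 2 / (2 * m) - μ)) = z⁻¹ := by
      rw [hz, Real.exp_neg, inv_inv]
    rw [h3]
    have h4 : 1 - z ≠ 0 := by linarith
    have h5 : z⁻¹ - 1 ≠ 0 := by
      have := (one_lt_inv₀ hz0).2 hz1
      linarith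
    field_simp
  rw [h2, ← h1]
  simp only [hFint]
  rw [tsum_mul_left, ← boseFunction]
  field_simp

theorem IsChemicalPotential.isFugacity (hd : 3 ≤ d) (hhbar : 0 < hbar) (hm : 0 < m) (hβ : 0 < β)
    (h : IsChemicalPotential d hbar m β ρ μ) :
    IsFugacity d (ρ * thermalLength hbar m β ^ d) (Real.exp (β * μ)) := by
  obtain ⟨hμ, h1, h2⟩ := h
  have hΛ := thermalLength_pos hhbar hm hβ
  have hΛd : 0 < thermalLength hbar m β ^ d := by positivity
  have heq : ρ ≤ criticalDensity d hbar m β →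
      boseFunction ((d : ℝ) / 2) (Real.exp (β * μ)) = ρ * thermalLength hbar m β ^ d := fun h => by
    have h3 := h1 h
    rw [integral_bose hd hhbar hm hβ hμ] at h3
    rw [h3]
    field_simp
  refine ⟨Real.exp_pos _, Real.exp_le_one_iff.2 (mul_nonpos_of_nonneg_of_nonpos hβ.le hμ), ?_, ?_⟩
  · rcases le_total ρ (criticalDensity d hbar m β) with h | h
    · exact (heq h).le
    · rw [h2 h, mul_zero, Real.exp_zero]
      rw [criticalDensity_eq, div_le_iff₀ hΛd] at h
      exact h
  · intro hx
    refine heq (le_of_not_ge fun h => ?_)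
    rw [h2 h, mul_zero, Real.exp_zero] at hx
    exact lt_irrefl _ hx

theorem existsUnique_isChemicalPotential (hd : 3 ≤ d) (hhbar : 0 < hbar) (hm : 0 < m) (hβ : 0 < β)
    (hρ : 0 < ρ) : ∃! μ, IsChemicalPotential d hbar m β ρ μ := by
  have hs : 1 < (d : ℝ) / 2 := by
    have : (3 : ℝ) ≤ d := by exact_mod_cast hd
    linarith
  have hΛ := thermalLength_pos hhbar hm hβ
  have hΛd : 0 < thermalLength hbar m β ^ d := by positivity
  have hmono := boseFunction_strictMonoOn hs
  have hmem : ∀ ν : ℝ, ν ≤ 0 → Real.exp (β * ν) ∈ Set.Icc (0 : ℝ) 1 := fun ν hν =>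
    ⟨(Real.exp_pos _).le, Real.exp_le_one_iff.2 (mul_nonpos_of_nonneg_of_nonpos hβ.le hν)⟩
  have hone : (1 : ℝ) ∈ Set.Icc (0 : ℝ) 1 := ⟨zero_le_one, le_rfl⟩
  rcases lt_or_ge (criticalDensity d hbar m β) ρ with hlt | hle
  · exact ⟨0, ⟨le_rfl, fun h => absurd h hlt.not_ge, fun _ => rfl⟩, fun ν hν => hν.2.2 hlt.le⟩
  · have hle' : ρ * thermalLength hbar m β ^ d ≤ boseFunction ((d : ℝ) / 2) 1 := by
      rwa [criticalDensity_eq, le_div_iff₀ hΛd] at hle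
    obtain ⟨x, hx, hgx⟩ := intermediate_value_Icc zero_le_one (boseFunction_continuousOn hs)
      (⟨by rw [boseFunction_zero]; positivity, hle'⟩ :
        ρ * thermalLength hbar m β ^ d ∈ Set.Icc (boseFunction ((d : ℝ) / 2) 0)
          (boseFunction ((d : ℝ) / 2) 1))
    have hx0 : 0 < x := by
      refine hx.1.lt_of_ne fun h => ?_
      rw [← h, boseFunction_zero] at hgx
      have : 0 < ρ * thermalLength hbar m β ^ d := by positivity
      exact this.ne hgx
    have hexp : Real.exp (β * (Real.log x / β)) = x := by
      rw [mul_div_cancel₀ _ hβ.ne', Real.exp_log hx0]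
    have hμ : Real.log x / β ≤ 0 :=
      div_nonpos_of_nonpos_of_nonneg (Real.log_nonpos hx.1 hx.2) hβ.le
    refine ⟨Real.log x / β, ⟨hμ, fun _ => ?_, fun h => ?_⟩, fun ν hν => ?_⟩
    · rw [integral_bose hd hhbar hm hβ hμ, hexp, hgx]
      field_simp
    · rw [criticalDensity_eq, div_le_iff₀ hΛd] at h
      have h1 : x = 1 := hmono.injOn hx hone (hgx.trans (le_antisymm hle' h))
      rw [h1, Real.log_one, zero_div]
    · have h1 := hν.2.1 hle
      rw [integral_bose hd hhbar hm hβ hν.1, eq_div_iff hΛd.ne', ← hgx] at h1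
      have h2 : x = Real.exp (β * ν) := hmono.injOn hx (hmem ν hν.1) h1
      rw [h2, Real.log_exp, mul_div_cancel_left₀ _ hβ.ne']

end ChemicalPotential

/-! ### The thermodynamic limit -/

section BoxLength

variable {d : ℕ} {ρ : ℝ}

theorem boxLength_pos (hρ : 0 < ρ) (N : ℕ) : 0 < boxLength d ρ (N + 1) :=
  Real.rpow_pos_of_pos (by positivity) _

theorem boxLength_pow (hd : d ≠ 0) (hρ : 0 < ρ) (N : ℕ) :
    boxLength d ρ (N + 1) ^ d = ((N : ℝ) + 1) / ρ := by
  rw [boxLength, one_div, Real.rpow_inv_natCast_pow (by positivity) hd]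
  push_cast
  rfl

theorem tendsto_boxLength (hd : d ≠ 0) (hρ : 0 < ρ) :
    Tendsto (fun N => boxLength d ρ (N + 1)) atTop atTop := by
  have hd' : (0 : ℝ) < 1 / (d : ℝ) := by positivity
  have h := (tendsto_rpow_atTop hd').comp
    ((tendsto_natCast_atTop_atTop (R := ℝ)).atTop_div_const hρ)
  exact (tendsto_add_atTop_iff_nat 1).2 h

end BoxLength

section Occupation

variable {d : ℕ} {Λ ρ x : ℝ} {Z : ℝ → ℕ → ℝ} {L : ℕ → ℝ}

theorem occupation_nonneg (hZ : ∀ L, 0 < L → IsBoseSequence (boxTrace d Λ L) (Z L))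
    (hLpos : ∀ N, 0 < L N) (N n : ℕ) : 0 ≤ Z (L N) (N - n) / Z (L N) (N + 1) :=
  div_nonneg ((hZ _ (hLpos N)).pos _).le ((hZ _ (hLpos N)).pos _).le

theorem occupation_le_one (hZ : ∀ L, 0 < L → IsBoseSequence (boxTrace d Λ L) (Z L))
    (hLpos : ∀ N, 0 < L N) (N n : ℕ) : Z (L N) (N - n) / Z (L N) (N + 1) ≤ 1 :=
  (div_le_one ((hZ _ (hLpos N)).pos _)).2 ((hZ _ (hLpos N)).mono (by omega))

/-- The condensate fraction. The weights of all cycle lengths add up to one, and the part of them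
that comes from excited modes converges, term by term, to the total weight of the finite cycles. -/
theorem tendsto_condensate_fraction (hd : 3 ≤ d) (hΛ : 0 < Λ) (hρ : 0 < ρ)
    (hZ : ∀ L, 0 < L → IsBoseSequence (boxTrace d Λ L) (Z L)) (hLpos : ∀ N, 0 < L N)
    (hLd : ∀ N, L N ^ d = ((N : ℝ) + 1) / ρ) (hL : Tendsto L atTop atTop)
    (hx : IsFugacity d (ρ * Λ ^ d) x) :
    Summable (cycleLaw d Λ ρ x) ∧
      Tendsto (fun N : ℕ => ∑ n ∈ Finset.range (N + 1),
        Z (L N) (N - n) / Z (L N) (N + 1) / ((N : ℝ) + 1)) atTop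
        (𝓝 (1 - ∑' n, cycleLaw d Λ ρ x n)) := by
  have hinv : Tendsto (fun N : ℕ => 1 / ((N : ℝ) + 1)) atTop (𝓝 0) :=
    tendsto_one_div_add_atTop_nhds_zero_nat
  have hr0 := occupation_nonneg hZ hLpos
  have hr1 := occupation_le_one hZ hLpos
  have h1 := tendsto_sum_excited hd hΛ hρ hLpos hLd hL hr0 hr1 (t := cycleLaw d Λ ρ x)
    (fun n => by
      have h2 : Tendsto (fun N : ℕ => Z (L N) (N - n) / Z (L N) (N + 1) / ((N : ℝ) + 1)) atTop
          (𝓝 0) :=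
        squeeze_zero (fun N => div_nonneg (hr0 N n) (by positivity))
          (fun N => div_le_div_of_nonneg_right (hr1 N n) (by positivity)) hinv
      have h3 := (tendsto_cycle_term hd hΛ hρ hZ hLpos hLd hL hx n).sub h2
      rw [sub_zero] at h3
      refine h3.congr fun N => ?_
      have := (hZ _ (hLpos N)).pos (N + 1)
      field_simp)
  refine ⟨h1.1, (h1.2.const_sub 1).congr fun N => ?_⟩
  have hB := hZ _ (hLpos N)
  have hN : (N : ℝ) + 1 ≠ 0 := by positivity
  have h4 : ∑ n ∈ Finset.range (N + 1), boxTrace d Λ (L N) (n + 1) *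
      (Z (L N) (N - n) / Z (L N) (N + 1) / ((N : ℝ) + 1)) = 1 := by
    have h5 := hB.recursion N
    have h6 := (hB.pos (N + 1)).ne'
    calc _ = (∑ n ∈ Finset.range (N + 1), boxTrace d Λ (L N) (n + 1) * Z (L N) (N - n)) /
          (((N : ℝ) + 1) * Z (L N) (N + 1)) := by
          rw [Finset.sum_div]
          exact Finset.sum_congr rfl fun n _ => by field_simp
      _ = 1 := by rw [← h5]; exact div_self (mul_ne_zero hN h6)
  simp only [sub_mul, one_mul, Finset.sum_sub_distrib]
  rw [h4]
  ring

/-- Long cycles: the traces `q_n` of the cycles with `n > ε N` may be replaced by the contribution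
`1` of the ground state. -/
theorem tendsto_long_cycles (hd : 3 ≤ d) (hΛ : 0 < Λ) (hρ : 0 < ρ)
    (hZ : ∀ L, 0 < L → IsBoseSequence (boxTrace d Λ L) (Z L)) (hLpos : ∀ N, 0 < L N)
    (hLd : ∀ N, L N ^ d = ((N : ℝ) + 1) / ρ) (hL : Tendsto L atTop atTop)
    (hx : IsFugacity d (ρ * Λ ^ d) x) {ε : ℝ} (hε : 0 < ε) :
    Tendsto (fun N : ℕ => ∑ n ∈ Finset.range (N + 1),
      if ε * ((N : ℝ) + 1) < ((n + 1 : ℕ) : ℝ) then boxTrace d Λ (L N) (n + 1) *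
        (Z (L N) (N - n) / Z (L N) (N + 1) / ((N : ℝ) + 1)) else 0) atTop
      (𝓝 (max (1 - ∑' n, cycleLaw d Λ ρ x n - ε) 0)) := by
  have hs : 1 < (d : ℝ) / 2 := by
    have : (3 : ℝ) ≤ d := by exact_mod_cast hd
    linarith
  have hr0 := occupation_nonneg hZ hLpos
  have hr1 := occupation_le_one hZ hLpos
  obtain ⟨hsum, hmean⟩ := tendsto_condensate_fraction hd hΛ hρ hZ hLpos hLd hL hx
  have hc : 0 < ρ * Λ ^ d := by positivity
  have hgx : 0 < boseFunction ((d : ℝ) / 2) x := by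
    have := boseFunction_strictMonoOn hs ⟨le_rfl, zero_le_one⟩ ⟨hx.pos.le, hx.le_one⟩ hx.pos
    rwa [boseFunction_zero] at this
  have ht0 : 0 ≤ 1 - ∑' n, cycleLaw d Λ ρ x n :=
    ge_of_tendsto hmean (Eventually.of_forall fun N => Finset.sum_nonneg fun n _ =>
      div_nonneg (hr0 N n) (by positivity))
  have ht1 : 1 - ∑' n, cycleLaw d Λ ρ x n < 1 := by
    rw [tsum_cycleLaw]
    have : 0 < boseFunction ((d : ℝ) / 2) x / (ρ * Λ ^ d) := by positivity
    linarith
  have hmain := tendsto_tail_of_saturated hr0 hr1 ht1 hmean (fun t ht ht1' => by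
    refine tendsto_tail_zero hd hΛ hρ hZ hLpos hLd hL (ht0.trans_lt ht) ht1' ?_
    rw [tsum_cycleLaw, sub_lt_comm, lt_div_iff₀ hc, ← mul_assoc] at ht
    exact ht.trans_le ((boseFunction_strictMonoOn hs).monotoneOn ⟨hx.pos.le, hx.le_one⟩
      ⟨zero_le_one, le_rfl⟩ hx.le_one)) hε
  -- the excited part of the long cycles vanishes term by term
  have hexc := (tendsto_sum_excited hd hΛ hρ hLpos hLd hL
    (r := fun N n => if ε * ((N : ℝ) + 1) < ((n + 1 : ℕ) : ℝ) then
      Z (L N) (N - n) / Z (L N) (N + 1) else 0) (t := fun _ => 0)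
    (fun N n => by
      split_ifs
      · exact hr0 N n
      · exact le_rfl)
    (fun N n => by
      split_ifs
      · exact hr1 N n
      · exact zero_le_one)
    (fun n => by
      refine tendsto_const_nhds.congr' ?_
      have h1 : Tendsto (fun N : ℕ => ε * ((N : ℝ) + 1)) atTop atTop :=
        (tendsto_atTop_add_const_right _ (1 : ℝ) tendsto_natCast_atTop_atTop).const_mul_atTop hε
      filter_upwards [h1.eventually_ge_atTop ((n + 1 : ℕ) : ℝ)] with N hN
      rw [if_neg hN.not_gt, zero_div, mul_zero])).2
  have h2 := hmain.add hexc
  rw [tsum_zero, add_zero] at h2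
  refine h2.congr fun N => ?_
  rw [← Finset.sum_add_distrib]
  refine Finset.sum_congr rfl fun n _ => ?_
  split_ifs
  · ring
  · simp

end Occupation

end IdealBose

end

theorem theorem3 (d : ℕ) (hd : 3 ≤ d) (hbar m β ρ : ℝ)
    (hhbar : 0 < hbar) (hm : 0 < m) (hβ : 0 < β) (hρ : 0 < ρ) :
    -- the chemical potential is well defined
    (∃! μ : ℝ, IdealBose.IsChemicalPotential d hbar m β ρ μ) ∧
    ∀ μ : ℝ, IdealBose.IsChemicalPotential d hbar m β ρ μ →
      -- `p n` is the probability, in the infinite system, that particle 1 is in a cycle of length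
      -- `n`; `R ε` is the thermodynamic limit of the probability of `ξ₁ > ε N`; `ρ₀` is the density
      -- of particles with zero momentum
      ∃ (p : ℕ → ℝ) (R : ℝ → ℝ) (ρ₀ : ℝ),
        (∀ n : ℕ, 1 ≤ n →
          Tendsto (fun N : ℕ =>
            IdealBose.cycleProb d hbar m β N (IdealBose.boxLength d ρ N) {n}) atTop (𝓝 (p n)) ∧
          p n = Real.exp (n * β * μ) /
            (ρ * IdealBose.thermalLength hbar m β ^ d * (n : ℝ) ^ ((d : ℝ) / 2))) ∧
        (∀ ε : ℝ, 0 < ε →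
          Tendsto (fun N : ℕ =>
            IdealBose.cycleProb d hbar m β N (IdealBose.boxLength d ρ N)
              {n : ℕ | ε * (N : ℝ) < (n : ℝ)}) atTop (𝓝 (R ε))) ∧
        Tendsto (fun N : ℕ =>
          IdealBose.zeroModeOccupation d hbar m β N (IdealBose.boxLength d ρ N) /
            IdealBose.boxLength d ρ N ^ d) atTop (𝓝 ρ₀) ∧
        Summable (fun n : ℕ => p (n + 1)) ∧
        Summable (fun n : ℕ =>
          Real.exp (((n + 1 : ℕ) : ℝ) * β * μ) / ((n + 1 : ℕ) : ℝ) ^ ((d : ℝ) / 2)) ∧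
        1 - ∑' n : ℕ, p (n + 1) =
          1 - 1 / (ρ * IdealBose.thermalLength hbar m β ^ d) *
            ∑' n : ℕ,
              Real.exp (((n + 1 : ℕ) : ℝ) * β * μ) / ((n + 1 : ℕ) : ℝ) ^ ((d : ℝ) / 2) ∧
        Tendsto R (𝓝[>] 0) (𝓝 (1 - ∑' n : ℕ, p (n + 1))) ∧
        1 - ∑' n : ℕ, p (n + 1) = ρ₀ / ρ := by
  open IdealBose in
  refine ⟨existsUnique_isChemicalPotential hd hhbar hm hβ hρ, fun μ hμ => ?_⟩
  have hs : 1 < (d : ℝ) / 2 := by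
    have : (3 : ℝ) ≤ d := by exact_mod_cast hd
    linarith
  have hx := hμ.isFugacity hd hhbar hm hβ
  have hΛ := thermalLength_pos hhbar hm hβ
  have hZ : ∀ L, 0 < L → IsBoseSequence (boxTrace d (thermalLength hbar m β) L)
      (bosonZ (boltzmann d hbar m β L)) := fun L hL => isBoseSequence_boltzmann hhbar hm hβ hL
  have hLpos := boxLength_pos (d := d) hρ
  have hLd := boxLength_pow (d := d) (by omega) hρ
  have hL := tendsto_boxLength (d := d) (by omega) hρ
  set Λ := thermalLength hbar m β with hΛ'
  set x := Real.exp (β * μ) with hx'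
  set p : ℕ → ℝ := fun n => Real.exp (n * β * μ) / (ρ * Λ ^ d * (n : ℝ) ^ ((d : ℝ) / 2)) with hp
  have hexp : ∀ n : ℕ, Real.exp (((n + 1 : ℕ) : ℝ) * β * μ) = x ^ (n + 1) := fun n => by
    rw [hx', ← Real.exp_nat_mul, mul_assoc]
  have hpn : ∀ n, p (n + 1) = cycleLaw d Λ ρ x n := fun n => by
    simp only [hp, hexp, cycleLaw]
  obtain ⟨hsum, hmean⟩ := tendsto_condensate_fraction hd hΛ hρ hZ hLpos hLd hL hx
  simp only [hexp]
  refine ⟨p, fun ε => max (1 - ∑' n, cycleLaw d Λ ρ x n - ε) 0,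
    ρ * (1 - ∑' n, cycleLaw d Λ ρ x n), fun n hn => ⟨?_, rfl⟩, fun ε hε => ?_, ?_, ?_,
    summable_bose hs hx.pos.le hx.le_one, ?_, ?_, ?_⟩
  · obtain ⟨k, rfl⟩ : ∃ k, n = k + 1 := ⟨n - 1, by omega⟩
    rw [hpn, ← tendsto_add_atTop_iff_nat 1]
    refine (tendsto_cycle_term hd hΛ hρ hZ hLpos hLd hL hx k).congr'
      ((eventually_ge_atTop k).mono fun N hN => ?_)
    change _ = cycleProb d hbar m β (N + 1) (boxLength d ρ (N + 1)) {k + 1}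
    rw [cycleProb_eq hhbar hm hβ (hLpos N), Finset.sum_eq_single k]
    · simp [hΛ']
    · intro b _ hb
      simp [hb]
    · intro h
      exact absurd (Finset.mem_range.2 (Nat.lt_succ_of_le hN)) h
  · rw [← tendsto_add_atTop_iff_nat 1]
    refine (tendsto_long_cycles hd hΛ hρ hZ hLpos hLd hL hx hε).congr fun N => ?_
    rw [cycleProb_eq hhbar hm hβ (hLpos N), ← hΛ']
    refine Finset.sum_congr rfl fun n _ => ?_
    have := (hZ _ (hLpos N)).pos (N + 1)
    have hmem : n + 1 ∈ {k : ℕ | ε * ((N + 1 : ℕ) : ℝ) < (k : ℝ)} ↔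
        ε * ((N : ℝ) + 1) < ((n + 1 : ℕ) : ℝ) := by
      rw [Set.mem_ofPred_eq, Nat.cast_succ N]
    by_cases h : ε * ((N : ℝ) + 1) < ((n + 1 : ℕ) : ℝ)
    · rw [if_pos h, Set.indicator_of_mem (hmem.2 h)]
      simp only [Pi.one_apply, one_mul]
      field_simp
    · rw [if_neg h, Set.indicator_of_notMem (mt hmem.1 h), zero_mul]
  · rw [← tendsto_add_atTop_iff_nat 1]
    refine (hmean.const_mul ρ).congr fun N => ?_
    rw [zeroModeOccupation_eq hhbar hm hβ (hLpos N), hLd, ← Finset.sum_div]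
    field_simp
  · simp only [hpn]
    exact hsum
  · simp only [hpn]
    rw [tsum_cycleLaw, boseFunction]
    ring
  · simp only [hpn]
    have hR0 : 0 ≤ 1 - ∑' n, cycleLaw d Λ ρ x n :=
      ge_of_tendsto hmean (Eventually.of_forall fun N => Finset.sum_nonneg fun n _ =>
        div_nonneg (occupation_nonneg hZ hLpos N n) (by positivity))
    have hR : Continuous fun ε : ℝ => max (1 - ∑' n, cycleLaw d Λ ρ x n - ε) 0 := by fun_prop
    have h := (hR.tendsto 0).mono_left (nhdsWithin_le_nhds (s := Set.Ioi 0))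
    simpa [max_eq_left hR0] using h
  · simp only [hpn]
    field_simp
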